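/- Let $k\ge 2$ be an integer and let $\mathbb{R}^k$ carry the $\ell^p$ metric for some fixed $1\le p\le\infty$ (e.g. the Euclidean metric, $p=2$, or the supremum metric, $p=\infty$). Let $f:[0,\infty)\to[0,\infty)$ be a dimension function, i.e. continuous, nondecreasing and with $f(r)\to 0$ as $r\to 0$, and assume that $r\mapsto r^{-k}f(r)$ is monotonic (nondecreasing or nonincreasing) on $(0,\infty)$. For $F\subset\mathbb{R}^k$ let $$\mathcal{H}^f(F)=\sup_{\rho>0}\ \inf\sum_i f(r_i),$$ where the infimum is over all countable collections of closed balls $B(x_i,r_i)$ with $0<r_i\le\rho$ that cover $F$. Let $\psi:\mathbb{N}\to[0,\infty)$ be any function ($\mathbb{N}=\{1,2,\dots\}$), not necessarily monotonic, and let $\mathcal{S}_k^*(\psi)$ be the set of points $(y_1,\dots,y_k)\in[0,1]^k$ for which there exist infinitely many pairs $(\mathbf{p},q)$ with $q\in\mathbb{N}$, $\mathbf{p}=(p_1,\dots,p_k)\in\mathbb{Z}^k$ and $\gcd(p_1,\dots,p_k,q)=1$ such that $$\left|y_i-\frac{p_i}{q}\right|<\frac{\psi(q)}{q}\qquad(1\le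 i\le k).$$ If $$\sum_{n=1}^\infty f\!\left(\frac{\psi(n)}{n}\right)n^k=\infty,$$ then $$\mathcal{H}^f(\mathcal{S}_k^*(\psi))=\mathcal{H}^f([0,1]^k).$$ -/

import Mathlib

open scoped NNReal ENNReal Topology

/-- A dimension function: continuous, nondecreasing, and tending to `0` at `0`. -/
structure IsDimensionFunction (f : ℝ≥0 → ℝ≥0) : Prop where
  continuous : Continuous f
  monotone : Monotone f
  tendsto_zero : Filter.Tendsto f (𝓝[>] 0) (𝓝 0)

/-- The function `r ↦ r⁻ᵏ f(r)` on `(0, ∞)` is monotonic, that is, nondecreasing or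
nonincreasing. -/
def RatioMonotonic (k : ℕ) (f : ℝ≥0 → ℝ≥0) : Prop :=
  MonotoneOn (fun r : ℝ≥0 => (r ^ k)⁻¹ * f r) (Set.Ioi 0) ∨
    AntitoneOn (fun r : ℝ≥0 => (r ^ k)⁻¹ * f r) (Set.Ioi 0)

/-- A `ρ`-cover of `F`: a countable collection of closed balls, recorded as pairs
(centre, radius), whose radii are positive and at most `ρ` and whose union contains `F`. -/
structure IsBallCover {X : Type*} [MetricSpace X] (ρ : ℝ≥0) (F : Set X)
    (s : Set (X × ℝ≥0)) : Prop where
  countable : s.Countable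
  radius_pos : ∀ b ∈ s, 0 < b.2
  radius_le : ∀ b ∈ s, b.2 ≤ ρ
  subset : F ⊆ ⋃ b ∈ s, Metric.closedBall b.1 (b.2 : ℝ)

/-- The `ρ`-premeasure: the infimum of `∑ f(r(B))` over all `ρ`-covers of `F`. -/
noncomputable def hausdorffPre {X : Type*} [MetricSpace X] (f : ℝ≥0 → ℝ≥0) (ρ : ℝ≥0)
    (F : Set X) : ℝ≥0∞ :=
  ⨅ (s : Set (X × ℝ≥0)) (_ : IsBallCover ρ F s), ∑' b : s, (f b.1.2 : ℝ≥0∞)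

/-- The Hausdorff `f`-measure of an arbitrary set `F`, through covers by balls. -/
noncomputable def hausdorffFMeasure {X : Type*} [MetricSpace X] (f : ℝ≥0 → ℝ≥0)
    (F : Set X) : ℝ≥0∞ :=
  ⨆ (ρ : ℝ≥0) (_ : 0 < ρ), hausdorffPre f ρ F

/-- The unit cube `[0,1]ᵏ`. -/
def unitCube (k : ℕ) : Set (Fin k → ℝ) :=
  {y | ∀ i, 0 ≤ y i ∧ y i ≤ 1}

/-- The points `y` of the unit cube for which there are infinitely many `(p, q)`, with `q ≥ 1` and
`gcd(p₁, …, pₖ, q) = 1`, such that `|yᵢ - pᵢ/q| < ψ(q)/q` for all `i`. -/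
def approxSetStar (k : ℕ) (ψ : ℕ → ℝ≥0) : Set (Fin k → ℝ) :=
  {y | y ∈ unitCube k ∧
    {pq : (Fin k → ℤ) × ℕ | 0 < pq.2 ∧
      Int.gcd (Finset.univ.gcd pq.1) (pq.2 : ℤ) = 1 ∧
      ∀ i, |y i - (pq.1 i : ℝ) / (pq.2 : ℝ)| < (ψ pq.2 : ℝ) / (pq.2 : ℝ)}.Infinite}

open MeasureTheory Metric

/-! The behaviour of f(r)/rᵏ near 0 decides the proof. If the ratio is bounded on (0, 1], divergence
of the series forces ∑ ψ(n)ᵏ = ∞. Gallagher's theorem then makes almost every point of the cube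
approximable, and Lebesgue null sets carry no Hausdorff f-measure. Otherwise the ratio increases to
infinity as r → 0 and both sides are infinite, by mass transference from Gallagher's theorem.

Gallagher's theorem (`ae_exists_mem_nearPrimitive`). Primitive fractions with different denominators
never coincide, so the neighbourhoods of denominators q ≠ r overlap in volume O(t(q)ᵏ t(r)ᵏ), with
no loss from gcd(q, r). Since ∑_{d ≥ 2} d⁻ᵏ < 1 for k ≥ 2, a positive proportion of the rational
points of large denominator in a fixed box is primitive, so each neighbourhood fills a proportion ≫
t(q)ᵏ of every fixed ball. A second moment argument localised near the supposed exceptional set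
(`ae_frequently_mem_of_quasiIndependent`) then gives full measure directly, without a zero-one law
and without monotonicity of ψ.

Mass transference (`hausdorffFMeasure_eq_top_of_ae`). No measure on a Cantor set is built. A cheap
cover is fixed, and nested balls of the system are chosen on which the cover stays cheap relative to
f of the radius. Their common point lies in the limsup set, hence in some ball of the cover, whose
cost eventually exceeds the budget. The step from one ball to the next (`exists_next_ball`) is a
pigeonhole over a finite family of disjoint small balls, stacked in enough layers for its total
content to beat the cost of the cover. `IsLayered.sum_hit_le` bounds the content that one covering
ball can meet. -/

/-! ### Primitive rational points: overlaps of neighbourhoods -/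

/-- The numerators `p ∈ [0, q)ᵏ` with `gcd(p₁, …, pₖ, q) = 1`. -/
noncomputable def primitivePoints (k q : ℕ) : Finset (Fin k → ℤ) :=
  (Fintype.piFinset fun _ => Finset.Ico (0 : ℤ) q).filter
    fun p => Int.gcd (Finset.univ.gcd p) (q : ℤ) = 1

/-- The rational point `p / q`. -/
noncomputable def ratPoint {k : ℕ} (q : ℕ) (p : Fin k → ℤ) : Fin k → ℝ := fun i => (p i : ℝ) / q

/-- The union of the balls of radius `t / q` around the primitive points of denominator `q`. -/
def nearPrimitive (k q : ℕ) (t : ℝ) : Set (Fin k → ℝ) :=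
  ⋃ p ∈ primitivePoints k q, closedBall (ratPoint q p) (t / q)

lemma mem_primitivePoints {k q : ℕ} {p : Fin k → ℤ} :
    p ∈ primitivePoints k q ↔
      (∀ i, 0 ≤ p i ∧ p i < q) ∧ Int.gcd (Finset.univ.gcd p) (q : ℤ) = 1 := by
  simp [primitivePoints]

lemma card_primitivePoints_le (k q : ℕ) : (primitivePoints k q).card ≤ q ^ k := by
  refine (Finset.card_filter_le _ _).trans ?_
  simp [Fintype.card_piFinset]

lemma measurableSet_nearPrimitive (k q : ℕ) (t : ℝ) : MeasurableSet (nearPrimitive k q t) :=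
  Finset.measurableSet_biUnion _ fun _ _ => isClosed_closedBall.measurableSet

/-- The number of pairs of fractions with denominators `q` and `r` at distance `≤ M / (q r)`. -/
lemma card_close_fractions_le {q r : ℕ} (hq : 0 < q) (hr : 0 < r) {M : ℝ}
    (hM : (Nat.gcd q r : ℝ) ≤ M) :
    ((((Finset.Ico (0 : ℤ) q) ×ˢ (Finset.Ico (0 : ℤ) r)).filter
      fun x => |(x.1 * r - x.2 * q : ℝ)| ≤ M).card : ℝ) ≤ 3 * M := by
  obtain ⟨q', r', hcop, hq', hr'⟩ := Nat.exists_coprime q r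
  set d := Nat.gcd q r with hd
  have hd0 : 0 < d := Nat.gcd_pos_of_pos_left _ hq
  have hq'0 : 0 < q' := Nat.pos_of_ne_zero (by rintro rfl; simp at hq'; omega)
  have hr'0 : 0 < r' := Nat.pos_of_ne_zero (by rintro rfl; simp at hr'; omega)
  have hdR : (0 : ℝ) < d := by exact_mod_cast hd0
  have hqR : (q : ℝ) = q' * d := by exact_mod_cast hq'
  have hrR : (r : ℝ) = r' * d := by exact_mod_cast hr'
  have hqZ : (q : ℤ) = q' * d := by exact_mod_cast hq'
  set m : ℤ := ⌊M / d⌋ with hm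
  have hm0 : 0 ≤ m := Int.floor_nonneg.2 (div_nonneg (hdR.le.trans hM) hdR.le)
  have hcard : (((Finset.Ico (0 : ℤ) q) ×ˢ (Finset.Ico (0 : ℤ) r)).filter
      fun x => |(x.1 * r - x.2 * q : ℝ)| ≤ M).card ≤
      (Finset.Icc (-m) m ×ˢ Finset.Ico (0 : ℤ) d).card := by
    -- With d = gcd(q, r), q = q'd and r = r'd, the integer a r' - b q' has absolute value at most
    -- M/d. It determines (a, b) up to multiples of (q', r'), and a / q' ∈ [0, d) selects the
    -- multiple. This leaves (2M/d + 1) d = 2M + d ≤ 3M pairs.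
    refine Finset.card_le_card_of_injOn
      (fun x => (x.1 * r' - x.2 * q', x.1 / q')) ?_ ?_
    · rintro ⟨a, b⟩ hx
      simp only [Finset.coe_filter, Finset.mem_product, Finset.mem_Ico, Set.mem_ofPred_eq] at hx
      obtain ⟨⟨⟨ha0, ha⟩, hb⟩, hx⟩ := hx
      have h1 : |((a * r' - b * q' : ℤ) : ℝ)| ≤ M / d := by
        rw [le_div_iff₀ hdR]
        nth_rewrite 1 [← abs_of_pos hdR]
        rw [← abs_mul]
        refine (congrArg abs ?_).trans_le hx
        push_cast
        rw [hqR, hrR]; ring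
      rw [abs_le] at h1
      simp only [Finset.coe_product, Set.mem_prod, Finset.mem_coe, Finset.mem_Icc, Finset.mem_Ico]
      refine ⟨⟨?_, ?_⟩, Int.ediv_nonneg ha0 (by positivity), ?_⟩
      · have : (-(a * r' - b * q') : ℤ) ≤ m := Int.le_floor.2 (by push_cast at h1 ⊢; linarith)
        linarith
      · exact Int.le_floor.2 h1.2
      · refine Int.ediv_lt_of_lt_mul (by exact_mod_cast hq'0) ?_
        rw [mul_comm, ← hqZ]; exact ha
    · rintro ⟨a, b⟩ - ⟨a', b'⟩ - h
      simp only [Prod.mk.injEq] at h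
      obtain ⟨h1, h2⟩ := h
      have h3 : (a - a') * r' = (b - b') * q' := by linarith
      have h4 : (q' : ℤ) ∣ (a - a') := by
        refine IsCoprime.dvd_of_dvd_mul_right (Nat.isCoprime_iff_coprime.2 hcop) (z := (r' : ℤ)) ?_
        exact ⟨b - b', by rw [h3]; ring⟩
      have h5 : a % q' = a' % q' := (Int.modEq_iff_dvd.2 h4).symm
      have h6 : a = a' := by
        rw [← Int.mul_ediv_add_emod a q', ← Int.mul_ediv_add_emod a' q', h2, h5]
      subst h6
      have h7 : (b - b') * q' = 0 := by rw [← h3]; ring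
      have : b - b' = 0 := by
        rcases mul_eq_zero.1 h7 with h | h
        · exact h
        · exfalso; have : q' = 0 := by exact_mod_cast h
          omega
      rw [show b = b' by linarith]
  have h2 : (Finset.Icc (-m) m ×ˢ Finset.Ico (0 : ℤ) d).card = (m + 1 + m).toNat * d := by
    simp [Finset.card_product]
  have h3 : (((m + 1 + m).toNat : ℕ) : ℝ) = 2 * m + 1 := by
    have : (((m + 1 + m).toNat : ℕ) : ℤ) = m + 1 + m := Int.toNat_of_nonneg (by omega)
    have := congrArg (Int.cast (R := ℝ)) this
    push_cast at this; rw [this]; ring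
  calc _ ≤ (((m + 1 + m).toNat * d : ℕ) : ℝ) := by rw [← h2]; exact_mod_cast hcard
    _ = (2 * m + 1) * d := by push_cast; rw [h3]
    _ ≤ (2 * (M / d) + 1) * d := by
        gcongr; exact Int.floor_le _
    _ = 2 * M + d := by field_simp
    _ ≤ 3 * M := by linarith

/-- Distinct denominators give distinct primitive fractions. -/
lemma eq_of_primitive_of_mul_eq {k q r : ℕ} {a b : Fin k → ℤ}
    (ha : Int.gcd (Finset.univ.gcd a) (q : ℤ) = 1) (hb : Int.gcd (Finset.univ.gcd b) (r : ℤ) = 1)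
    (h : ∀ i, a i * r = b i * q) : q = r := by
  have key : ∀ {q r : ℕ} {a b : Fin k → ℤ}, Int.gcd (Finset.univ.gcd a) (q : ℤ) = 1 →
      (∀ i, a i * r = b i * q) → q ∣ r := by
    intro q r a b ha h
    have h1 : (q : ℤ) ∣ Finset.univ.gcd (fun i => (r : ℤ) * a i) :=
      Finset.dvd_gcd fun i _ => ⟨b i, by rw [mul_comm, h i]; ring⟩
    rw [Finset.gcd_mul_left] at h1
    have h2 : IsCoprime (q : ℤ) (Finset.univ.gcd a) := (Int.isCoprime_iff_gcd_eq_one.2 ha).symm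
    have h3 := h2.dvd_of_dvd_mul_right h1
    rw [dvd_normalize_iff] at h3
    exact_mod_cast h3
  exact Nat.dvd_antisymm (key ha h) (key hb fun i => (h i).symm)

/-- When gcd(q, r) ≤ M the coordinates are counted independently. When gcd(q, r) > M, each a i * r -
b i * q is a multiple of the gcd smaller than it, hence zero; the two primitive fractions would
coincide, which q ≠ r forbids. This is the only use of primitivity in the overlap bound. -/
lemma card_close_primitive_le {k q r : ℕ} (hq : 0 < q) (hr : 0 < r) (hne : q ≠ r) {M : ℝ}
    (hM : 0 ≤ M) :
    (((primitivePoints k q ×ˢ primitivePoints k r).filter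
      fun x => ∀ i, |(x.1 i * r - x.2 i * q : ℝ)| ≤ M).card : ℝ) ≤ (3 * M) ^ k := by
  rcases le_or_gt (Nat.gcd q r : ℝ) M with h | h
  · set T := ((Finset.Ico (0 : ℤ) q) ×ˢ (Finset.Ico (0 : ℤ) r)).filter
      fun x => |(x.1 * r - x.2 * q : ℝ)| ≤ M with hT
    have h1 : ((primitivePoints k q ×ˢ primitivePoints k r).filter
        fun x => ∀ i, |(x.1 i * r - x.2 i * q : ℝ)| ≤ M).card ≤
        (Fintype.piFinset fun _ : Fin k => T).card := by
      refine Finset.card_le_card_of_injOn (fun x i => (x.1 i, x.2 i)) ?_ ?_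
      · rintro ⟨a, b⟩ hx
        simp only [Finset.coe_filter, Finset.mem_product, mem_primitivePoints,
          Set.mem_ofPred_eq] at hx
        simp only [Finset.mem_coe, Fintype.mem_piFinset, hT, Finset.mem_filter, Finset.mem_product,
          Finset.mem_Ico]
        exact fun i => ⟨⟨hx.1.1.1 i, hx.1.2.1 i⟩, hx.2 i⟩
      · rintro ⟨a, b⟩ - ⟨a', b'⟩ - hab
        have h2 := fun i => Prod.mk_inj.1 (congrFun hab i)
        exact Prod.ext (funext fun i => (h2 i).1) (funext fun i => (h2 i).2)
    rw [Fintype.card_piFinset, Finset.prod_const, Finset.card_univ, Fintype.card_fin] at h1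
    calc _ ≤ ((T.card ^ k : ℕ) : ℝ) := by exact_mod_cast h1
      _ = (T.card : ℝ) ^ k := by push_cast; rfl
      _ ≤ _ := by gcongr; exact card_close_fractions_le hq hr h
  · rw [Finset.filter_false_of_mem]
    · simp; positivity
    · rintro ⟨a, b⟩ hx hab
      simp only [Finset.mem_product, mem_primitivePoints] at hx
      refine hne (eq_of_primitive_of_mul_eq hx.1.2 hx.2.2 fun i => ?_)
      have h1 : (Nat.gcd q r : ℤ) ∣ a i * r - b i * q :=
        dvd_sub (Dvd.dvd.mul_left (by exact_mod_cast Nat.gcd_dvd_right q r) _)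
          (Dvd.dvd.mul_left (by exact_mod_cast Nat.gcd_dvd_left q r) _)
      have h2 : |a i * r - b i * q| < (Nat.gcd q r : ℤ) := by
        have := (hab i).trans_lt h
        exact_mod_cast this
      have := Int.eq_zero_of_abs_lt_dvd h1 h2
      linarith

/-- The intersection is covered by the smaller balls, of radius t/q, whose centre is within 2u/r of
a centre of denominator r. There are at most (6uq)ᵏ such pairs, each contributing volume (2t/q)ᵏ. -/
lemma volume_nearPrimitive_inter_le_aux {k q r : ℕ} (hq : 0 < q) (hr : 0 < r) (hne : q ≠ r)
    {t u : ℝ} (ht : 0 ≤ t) (hu : 0 ≤ u) (h : t / q ≤ u / r) :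
    volume (nearPrimitive k q t ∩ nearPrimitive k r u) ≤ ENNReal.ofReal ((12 * t * u) ^ k) := by
  have hqR : (0 : ℝ) < q := by exact_mod_cast hq
  have hrR : (0 : ℝ) < r := by exact_mod_cast hr
  set M : ℝ := 2 * (u / r) * (q * r) with hM
  have hM0 : 0 ≤ M := by positivity
  set F := (primitivePoints k q ×ˢ primitivePoints k r).filter
      fun x => ∀ i, |(x.1 i * r - x.2 i * q : ℝ)| ≤ M with hF
  have hsub : nearPrimitive k q t ∩ nearPrimitive k r u ⊆
      ⋃ x ∈ F, closedBall (ratPoint q x.1) (t / q) := by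
    rintro y ⟨h1, h2⟩
    simp only [nearPrimitive, Set.mem_iUnion] at h1 h2 ⊢
    obtain ⟨a, ha, hya⟩ := h1
    obtain ⟨b, hb, hyb⟩ := h2
    refine ⟨(a, b), ?_, hya⟩
    simp only [hF, Finset.mem_filter, Finset.mem_product]
    refine ⟨⟨ha, hb⟩, fun i => ?_⟩
    have h3 : dist (ratPoint q a) (ratPoint r b) ≤ 2 * (u / r) :=
      (dist_triangle_left _ _ y).trans (by
        have := mem_closedBall.1 hya; have := mem_closedBall.1 hyb; linarith)
    have h4 := (dist_le_pi_dist _ _ i).trans h3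
    rw [Real.dist_eq] at h4
    have h5 : (a i * r - b i * q : ℝ) = (ratPoint q a i - ratPoint r b i) * (q * r) := by
      simp only [ratPoint]; field_simp
    rw [h5, abs_mul, abs_of_pos (mul_pos hqR hrR)]
    exact mul_le_mul_of_nonneg_right h4 (by positivity)
  calc _ ≤ volume (⋃ x ∈ F, closedBall (ratPoint q x.1) (t / q)) := measure_mono hsub
    _ ≤ ∑ x ∈ F, volume (closedBall (ratPoint q x.1) (t / q)) := measure_biUnion_finset_le _ _
    _ = F.card * ENNReal.ofReal ((2 * (t / q)) ^ k) := by
        simp [Real.volume_pi_closedBall _ (div_nonneg ht hqR.le)]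
    _ = ENNReal.ofReal (F.card * (2 * (t / q)) ^ k) := by
        rw [ENNReal.ofReal_mul (by positivity), ENNReal.ofReal_natCast]
    _ ≤ ENNReal.ofReal ((3 * M) ^ k * (2 * (t / q)) ^ k) := by
        gcongr
        exact card_close_primitive_le hq hr hne hM0
    _ = _ := by
        rw [← mul_pow, hM]; congr 2; field_simp; ring

lemma volume_nearPrimitive_inter_le {k q r : ℕ} (hq : 0 < q) (hr : 0 < r) (hne : q ≠ r)
    {t u : ℝ} (ht : 0 ≤ t) (hu : 0 ≤ u) :
    volume (nearPrimitive k q t ∩ nearPrimitive k r u) ≤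
      ENNReal.ofReal (12 ^ k * t ^ k * u ^ k) := by
  rw [← mul_pow, ← mul_pow]
  rcases le_total (t / q) (u / r) with h | h
  · exact volume_nearPrimitive_inter_le_aux hq hr hne ht hu h
  · rw [Set.inter_comm]
    convert volume_nearPrimitive_inter_le_aux hr hq hne.symm hu ht h using 3
    ring

lemma volume_nearPrimitive_le (k : ℕ) {q : ℕ} (hq : 0 < q) {t : ℝ} (ht : 0 ≤ t) :
    volume (nearPrimitive k q t) ≤ ENNReal.ofReal (2 ^ k * t ^ k) := by
  have hqR : (0 : ℝ) < q := by exact_mod_cast hq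
  calc _ ≤ ∑ p ∈ primitivePoints k q, volume (closedBall (ratPoint q p) (t / q)) :=
        measure_biUnion_finset_le _ _
    _ = (primitivePoints k q).card * ENNReal.ofReal ((2 * (t / q)) ^ k) := by
        simp [Real.volume_pi_closedBall _ (div_nonneg ht hqR.le)]
    _ = ENNReal.ofReal ((primitivePoints k q).card * (2 * (t / q)) ^ k) := by
        rw [ENNReal.ofReal_mul (by positivity), ENNReal.ofReal_natCast]
    _ ≤ ENNReal.ofReal ((q : ℝ) ^ k * (2 * (t / q)) ^ k) := by
        gcongr; exact_mod_cast card_primitivePoints_le k q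
    _ = _ := by
        rw [← mul_pow, ← mul_pow]; congr 2; field_simp

/-! ### Primitive points in a box: local lower density -/

/-- Telescoping from the exact value 1/4 at n = 2. What matters later is that 7/6 · 3/4 = 7/8 is
below 1. -/
lemma sum_Icc_inv_sq_le (n : ℕ) : ∑ d ∈ Finset.Icc 2 n, (1 / (d : ℝ) ^ 2) ≤ 3 / 4 := by
  have key : ∀ n : ℕ, 2 ≤ n →
      ∑ d ∈ Finset.Icc 2 n, (1 / (d : ℝ) ^ 2) ≤ 3 / 4 - 1 / (n : ℝ) := by
    intro n hn
    induction n, hn using Nat.le_induction with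
    | base => norm_num
    | succ n hn ih =>
      rw [← Finset.insert_Icc_right_eq_Icc_add_one (by omega), Finset.sum_insert (by simp)]
      have hn0 : (0 : ℝ) < n := by exact_mod_cast (by omega : 0 < n)
      have : 1 / ((n + 1 : ℕ) : ℝ) ^ 2 ≤ 1 / (n : ℝ) - 1 / ((n + 1 : ℕ) : ℝ) := by
        push_cast
        rw [div_sub_div _ _ hn0.ne' (by positivity), div_le_div_iff₀ (by positivity) (by positivity)]
        nlinarith
      linarith
  rcases lt_or_ge n 2 with h | h
  · rw [Finset.Icc_eq_empty (by omega)]; norm_num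
  · have := key n h
    have h2 : (0 : ℝ) ≤ 1 / (n : ℝ) := by positivity
    linarith

/-- Integers in a half-open interval, with a prescribed divisor. -/
lemma card_Ioc_filter_dvd_le {u v : ℝ} (huv : u ≤ v) {d : ℕ} (hd : 0 < d) :
    ((((Finset.Ioc ⌊u⌋ ⌊v⌋).filter fun p : ℤ => (d : ℤ) ∣ p).card : ℕ) : ℝ) ≤ (v - u) / d + 1 := by
  have hdR : (0 : ℝ) < d := by exact_mod_cast hd
  have hdZ : (0 : ℤ) < d := by exact_mod_cast hd
  have h := Int.Ioc_filter_dvd_card ⌊u⌋ ⌊v⌋ hdZ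
  have h' := congrArg (Int.cast (R := ℝ)) h
  rw [Int.cast_natCast] at h'
  rw [h']
  have e : ∀ w : ℝ, ⌊((⌊w⌋ : ℤ) : ℚ) / ((d : ℤ) : ℚ)⌋ = ⌊w / d⌋ := by
    intro w
    rw [Int.cast_natCast, Rat.floor_intCast_div_natCast, Int.floor_div_natCast]
  rw [e, e]
  push_cast
  refine max_le ?_ ?_
  · have h1 := Int.floor_le (v / d)
    have h2 := Int.lt_floor_add_one (u / d)
    rw [sub_div]; linarith
  · have : 0 ≤ (v - u) / d := div_nonneg (by linarith) hdR.le
    linarith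

lemma le_card_Ioc {u v : ℝ} : v - u - 1 ≤ (((Finset.Ioc ⌊u⌋ ⌊v⌋).card : ℕ) : ℝ) := by
  rw [Int.card_Ioc]
  have h : (⌊v⌋ - ⌊u⌋ : ℤ) ≤ ((⌊v⌋ - ⌊u⌋).toNat : ℤ) := Int.self_le_toNat _
  have h' : ((⌊v⌋ - ⌊u⌋ : ℤ) : ℝ) ≤ (((⌊v⌋ - ⌊u⌋).toNat : ℤ) : ℝ) := by exact_mod_cast h
  have h1 := Int.floor_le u
  have h2 := Int.lt_floor_add_one v
  push_cast at h'
  linarith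

/-- The primitive points of denominator `q` in the box of radius `ρ / 2` around `x`. -/
noncomputable def boxPrimitive {k : ℕ} (q : ℕ) (x : Fin k → ℝ) (ρ : ℝ) : Finset (Fin k → ℤ) :=
  (Fintype.piFinset fun i => Finset.Ioc ⌊q * x i - q * ρ / 2⌋ ⌊q * x i + q * ρ / 2⌋).filter
    fun p => Int.gcd (Finset.univ.gcd p) (q : ℤ) = 1

/-- Union bound: a non-primitive p has all its coordinates divisible by d = gcd(p, q), and 2 ≤ d ≤
q. -/
lemma le_card_boxPrimitive {k q : ℕ} (hq : 0 < q) (x : Fin k → ℝ) {ρ : ℝ} (hρ : 1 ≤ q * ρ) :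
    (q * ρ - 1) ^ k - ∑ d ∈ Finset.Icc 2 q, (q * ρ / d + 1) ^ k ≤
      ((boxPrimitive q x ρ).card : ℝ) := by
  set I : Fin k → Finset ℤ := fun i =>
    Finset.Ioc ⌊q * x i - q * ρ / 2⌋ ⌊q * x i + q * ρ / 2⌋ with hI
  set bad : ℕ → Finset (Fin k → ℤ) := fun d =>
    Fintype.piFinset fun i => (I i).filter fun p : ℤ => (d : ℤ) ∣ p with hbad
  have h1 : Fintype.piFinset I ⊆ boxPrimitive q x ρ ∪ (Finset.Icc 2 q).biUnion bad := by
    intro p hp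
    by_cases hg : Int.gcd (Finset.univ.gcd p) (q : ℤ) = 1
    · exact Finset.mem_union_left _ (Finset.mem_filter.2 ⟨hp, hg⟩)
    · refine Finset.mem_union_right _ (Finset.mem_biUnion.2
        ⟨Int.gcd (Finset.univ.gcd p) (q : ℤ), ?_, ?_⟩)
      · have h2 : Int.gcd (Finset.univ.gcd p) (q : ℤ) ∣ q := by
          have := Int.gcd_dvd_right (Finset.univ.gcd p) (q : ℤ)
          exact_mod_cast this
        have := Nat.le_of_dvd hq h2
        have := Nat.pos_of_dvd_of_pos h2 hq
        rw [Finset.mem_Icc]; omega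
      · simp only [hbad, Fintype.mem_piFinset, Finset.mem_filter]
        rw [Fintype.mem_piFinset] at hp
        exact fun i => ⟨hp i, (Int.gcd_dvd_left _ _).trans (Finset.gcd_dvd (Finset.mem_univ i))⟩
  have h2 : (q * ρ - 1) ^ k ≤ ((Fintype.piFinset I).card : ℝ) := by
    rw [Fintype.card_piFinset]
    push_cast
    calc (q * ρ - 1) ^ k = ∏ _i : Fin k, (q * ρ - 1) := by simp
      _ ≤ _ := Finset.prod_le_prod (fun _ _ => by linarith) fun i _ => by
        refine le_trans (le_of_eq ?_) le_card_Ioc; ring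
  have h3 : ∀ d ∈ Finset.Icc 2 q, ((bad d).card : ℝ) ≤ (q * ρ / d + 1) ^ k := by
    intro d hd
    rw [Finset.mem_Icc] at hd
    rw [Fintype.card_piFinset]
    push_cast
    calc _ ≤ ∏ _i : Fin k, (q * ρ / d + 1) :=
          Finset.prod_le_prod (fun _ _ => by positivity) fun i _ => by
            refine (card_Ioc_filter_dvd_le (by linarith) (by omega)).trans (le_of_eq ?_); ring
      _ = _ := by simp
  have h4 : ((Fintype.piFinset I).card : ℝ) ≤
      (boxPrimitive q x ρ).card + ∑ d ∈ Finset.Icc 2 q, ((bad d).card : ℝ) := by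
    have := (Finset.card_le_card h1).trans ((Finset.card_union_le _ _).trans
      (Nat.add_le_add_left Finset.card_biUnion_le _))
    exact_mod_cast this
  have h5 := Finset.sum_le_sum h3
  linarith

/-- With l = qρ, the main term is at least (31/32) lᵏ and the non-primitive points number at most
(7/8 + 1/32) lᵏ, leaving lᵏ/16. The three thresholds on q beyond positivity give l ≥ 2, the
Bernoulli loss of 1/32, and the 1/32 coming from the rounding terms 7/l² summed over d ≤ q. -/
lemma eventually_le_card_boxPrimitive {k : ℕ} (hk : 2 ≤ k) {ρ : ℝ} (hρ : 0 < ρ) :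
    ∀ᶠ q : ℕ in Filter.atTop, ∀ x : Fin k → ℝ,
      (q * ρ) ^ k / 16 ≤ ((boxPrimitive q x ρ).card : ℝ) := by
  have hlim : Filter.Tendsto (fun q : ℕ => (q : ℝ)) Filter.atTop Filter.atTop :=
    tendsto_natCast_atTop_atTop
  filter_upwards [hlim.eventually_ge_atTop (2 / ρ), hlim.eventually_ge_atTop (32 * k / ρ),
    hlim.eventually_ge_atTop (32 * 7 / ρ ^ 2), Filter.eventually_gt_atTop 0] with q h1 h2 h3 hq x
  have hqR : (0 : ℝ) < q := by exact_mod_cast hq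
  rw [div_le_iff₀ hρ] at h1 h2
  rw [div_le_iff₀ (by positivity)] at h3
  refine le_trans ?_ (le_card_boxPrimitive hq x (by linarith))
  set l : ℝ := q * ρ with hl
  have hl0 : 0 < l := by positivity
  have h4 : l ^ k * (1 - 1 / 32) ≤ (l - 1) ^ k := by
    have hb := one_add_mul_le_pow (a := -(1 / l)) (by
      have : 1 / l ≤ 1 := by rw [div_le_one hl0]; linarith
      linarith) k
    have hk' : (k : ℝ) * (1 / l) ≤ 1 / 32 := by
      rw [mul_one_div, div_le_iff₀ hl0]; linarith
    have e : (l - 1) = l * (1 + -(1 / l)) := by field_simp; ring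
    rw [e, mul_pow l]
    have h4' : 1 - 1 / 32 ≤ (1 + -(1 / l)) ^ k := by
      rw [mul_neg] at hb; linarith
    exact mul_le_mul_of_nonneg_left h4' (by positivity)
  have h5 : ∀ d ∈ Finset.Icc 2 q,
      (l / d + 1) ^ k ≤ l ^ k * (7 / 6 * (1 / (d : ℝ) ^ 2) + 7 / l ^ 2) := by
    intro d hd
    rw [Finset.mem_Icc] at hd
    have hd2 : (2 : ℝ) ≤ d := by exact_mod_cast hd.1
    have hd0 : (0 : ℝ) < d := by linarith
    have e : l / d + 1 = l * (1 / d + 1 / l) := by field_simp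
    rw [e, mul_pow]
    gcongr
    have h6 : 1 / (d : ℝ) ≤ 1 / 2 := one_div_le_one_div_of_le (by norm_num) hd2
    have h7 : 1 / l ≤ 1 / 2 := one_div_le_one_div_of_le (by norm_num) (by linarith)
    -- The base is at most 1, so k ≥ 2 reduces the exponent to 2. Then 2ab ≤ a²/6 + 6b² keeps the
    -- coefficient of 1/d² as small as 7/6.
    calc (1 / (d : ℝ) + 1 / l) ^ k ≤ (1 / (d : ℝ) + 1 / l) ^ 2 :=
          pow_le_pow_of_le_one (by positivity) (by linarith) hk
      _ ≤ 7 / 6 * (1 / (d : ℝ)) ^ 2 + 7 * (1 / l) ^ 2 := by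
          nlinarith [sq_nonneg (1 / (d : ℝ) - 6 * (1 / l))]
      _ = _ := by rw [one_div_pow, one_div_pow]; ring
  have h6 : ∑ d ∈ Finset.Icc 2 q, (l / d + 1) ^ k ≤ l ^ k * (7 / 8 + 1 / 32) := by
    refine (Finset.sum_le_sum h5).trans ?_
    rw [← Finset.mul_sum, Finset.sum_add_distrib, ← Finset.mul_sum, Finset.sum_const, Nat.card_Icc,
      nsmul_eq_mul]
    gcongr
    · have := sum_Icc_inv_sq_le q
      linarith
    · have h7 : ((q + 1 - 2 : ℕ) : ℝ) ≤ q := by exact_mod_cast (by omega : q + 1 - 2 ≤ q)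
      calc _ ≤ (q : ℝ) * (7 / l ^ 2) := by gcongr
        _ ≤ _ := by
          rw [hl, mul_pow, mul_div_assoc', div_le_div_iff₀ (by positivity) (by positivity)]
          nlinarith
  have h7 : 0 < l ^ k := by positivity
  linarith

lemma boxPrimitive_subset {k q : ℕ} (hq : 0 < q) {x : Fin k → ℝ} {ρ : ℝ} (hρ : 0 < ρ)
    (h0 : ∀ i, 0 ≤ x i - ρ) (h1 : ∀ i, x i + ρ ≤ 1) :
    boxPrimitive q x ρ ⊆ primitivePoints k q := by
  have hqR : (0 : ℝ) < q := by exact_mod_cast hq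
  intro p hp
  simp only [boxPrimitive, Finset.mem_filter, Fintype.mem_piFinset, Finset.mem_Ioc] at hp
  refine mem_primitivePoints.2 ⟨fun i => ?_, hp.2⟩
  have h2 := Int.floor_lt.1 (hp.1 i).1
  have h3 := Int.le_floor.1 (hp.1 i).2
  constructor
  · have : (0 : ℝ) < p i := by nlinarith [h0 i]
    exact_mod_cast this.le
  · have : (p i : ℝ) < q := by nlinarith [h1 i]
    exact_mod_cast this

lemma closedBall_ratPoint_subset {k q : ℕ} (hq : 0 < q) {x : Fin k → ℝ} {ρ t : ℝ}
    (hρ : 0 < ρ) (ht : t ≤ q * ρ / 2) {p : Fin k → ℤ} (hp : p ∈ boxPrimitive q x ρ) :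
    closedBall (ratPoint q p) (t / q) ⊆ closedBall x ρ := by
  have hqR : (0 : ℝ) < q := by exact_mod_cast hq
  simp only [boxPrimitive, Finset.mem_filter, Fintype.mem_piFinset, Finset.mem_Ioc] at hp
  refine closedBall_subset_closedBall' ?_
  have h1 : dist (ratPoint q p) x ≤ ρ / 2 := by
    refine (dist_pi_le_iff (by positivity)).2 fun i => ?_
    have h2 := Int.floor_lt.1 (hp.1 i).1
    have h3 := Int.le_floor.1 (hp.1 i).2
    rw [Real.dist_eq, abs_le, ratPoint]
    constructor
    · rw [neg_le_sub_iff_le_add, ← sub_le_iff_le_add, le_div_iff₀ hqR]; nlinarith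
    · rw [sub_le_iff_le_add, div_le_iff₀ hqR]; nlinarith
  have h2 : t / q ≤ ρ / 2 := by rw [div_le_iff₀ hqR]; linarith
  linarith

lemma disjoint_closedBall_ratPoint {k q : ℕ} (hq : 0 < q) {t : ℝ} (ht : t ≤ 1 / 4)
    {p p' : Fin k → ℤ} (h : p ≠ p') :
    Disjoint (closedBall (ratPoint q p) (t / q)) (closedBall (ratPoint q p') (t / q)) := by
  have hqR : (0 : ℝ) < q := by exact_mod_cast hq
  refine closedBall_disjoint_closedBall ?_
  obtain ⟨i, hi⟩ := Function.ne_iff.1 h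
  refine lt_of_lt_of_le ?_ (dist_le_pi_dist _ _ i)
  have h1 : (1 : ℝ) ≤ |(p i : ℝ) - p' i| := by
    have := Int.one_le_abs (sub_ne_zero.2 hi)
    exact_mod_cast this
  rw [Real.dist_eq, ratPoint, ratPoint, ← sub_div, abs_div, abs_of_pos hqR, ← add_div]
  gcongr
  linarith

/-- For t ≤ 1/4 the balls around distinct points of denominator q are disjoint, so their volumes add
up. Centres are taken in the box of half the radius so that whole balls stay inside the given one.
-/
lemma eventually_le_volume_nearPrimitive_inter {k : ℕ} (hk : 2 ≤ k) {t : ℕ → ℝ}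
    (ht0 : ∀ q, 0 ≤ t q) (ht : ∀ q, t q ≤ 1 / 4) {x : Fin k → ℝ} {ρ : ℝ} (hρ : 0 < ρ)
    (h0 : ∀ i, 0 ≤ x i - ρ) (h1 : ∀ i, x i + ρ ≤ 1) :
    ∀ᶠ q : ℕ in Filter.atTop, ENNReal.ofReal (t q ^ k / 16) * volume (closedBall x ρ) ≤
      volume (nearPrimitive k q (t q) ∩ closedBall x ρ) := by
  have hlim : Filter.Tendsto (fun q : ℕ => (q : ℝ)) Filter.atTop Filter.atTop :=
    tendsto_natCast_atTop_atTop
  filter_upwards [eventually_le_card_boxPrimitive hk hρ, Filter.eventually_gt_atTop 0,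
    hlim.eventually_ge_atTop (1 / (2 * ρ))] with q hcard hq hq2
  have hqR : (0 : ℝ) < q := by exact_mod_cast hq
  rw [div_le_iff₀ (by positivity)] at hq2
  have htq : t q ≤ q * ρ / 2 := by linarith [ht q]
  have hsub : (⋃ p ∈ boxPrimitive q x ρ, closedBall (ratPoint q p) (t q / q)) ⊆
      nearPrimitive k q (t q) ∩ closedBall x ρ :=
    Set.iUnion₂_subset fun p hp => Set.subset_inter
      (Set.subset_biUnion_of_mem (u := fun p => closedBall (ratPoint q p) (t q / q))
        (boxPrimitive_subset hq hρ h0 h1 hp))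
      (closedBall_ratPoint_subset hq hρ htq hp)
  refine le_trans ?_ (measure_mono hsub)
  rw [measure_biUnion_finset
    (fun p _ p' _ h => disjoint_closedBall_ratPoint hq (ht q) h)
    fun _ _ => isClosed_closedBall.measurableSet]
  simp only [Real.volume_pi_closedBall _ (div_nonneg (ht0 q) hqR.le),
    Real.volume_pi_closedBall _ hρ.le, Fintype.card_fin, Finset.sum_const, nsmul_eq_mul]
  have := ht0 q
  rw [← ENNReal.ofReal_natCast, ← ENNReal.ofReal_mul (by positivity),
    ← ENNReal.ofReal_mul (by positivity)]
  refine ENNReal.ofReal_le_ofReal ?_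
  calc t q ^ k / 16 * (2 * ρ) ^ k = (q * ρ) ^ k / 16 * (2 * (t q / q)) ^ k := by
        have : q * ρ * (2 * (t q / q)) = t q * (2 * ρ) := by field_simp
        rw [div_mul_eq_mul_div, div_mul_eq_mul_div, ← mul_pow, ← mul_pow, this]
    _ ≤ _ := by gcongr; exact hcard x

/-! ### Second moments and a full-measure limsup -/

/-- A divergence Borel–Cantelli lemma: sets `E q` that are pairwise quasi-independent and that
meet, in the right proportion, sets `V` approximating an arbitrary set of positive measure, have a
limsup of full measure. -/
theorem ae_frequently_mem_of_quasiIndependent {X : Type*} [MeasurableSpace X] (μ : Measure X)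
    [IsFiniteMeasure μ] {E : ℕ → Set X} (hE : ∀ q, MeasurableSet (E q)) {a : ℕ → ℝ}
    (ha : ∀ q, 0 ≤ a q) (hdiv : ¬ Summable a) {C c : ℝ} (hC : 0 < C) (hc : 0 < c)
    (h1 : ∀ q, μ.real (E q) ≤ C * a q)
    (h2 : ∀ q r, q ≠ r → μ.real (E q ∩ E r) ≤ C * (a q * a r))
    (h3 : ∀ G, MeasurableSet G → μ G ≠ 0 → ∀ ε : ℝ, 0 < ε → ∃ V, MeasurableSet V ∧
      μ.real (V \ G) ≤ ε ∧ μ.real G / 2 ≤ μ.real V ∧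
      ∀ᶠ q in Filter.atTop, c * a q * μ.real V ≤ μ.real (E q ∩ V)) :
    ∀ᵐ y ∂μ, ∃ᶠ q in Filter.atTop, y ∈ E q := by
  set N : ℕ → X → ℝ := fun Q y => ∑ q ∈ Finset.range Q, (E q).indicator 1 y with hN
  set S : ℕ → ℝ := fun Q => ∑ q ∈ Finset.range Q, a q with hS
  have hSlim : Filter.Tendsto S Filter.atTop Filter.atTop :=
    (not_summable_iff_tendsto_nat_atTop_of_nonneg ha).1 hdiv
  have hN0 : ∀ Q y, 0 ≤ N Q y := fun Q y =>
    Finset.sum_nonneg fun q _ => Set.indicator_nonneg (fun _ _ => zero_le_one) y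
  have hNle : ∀ Q y, N Q y ≤ Q := fun Q y => by
    calc N Q y ≤ ∑ q ∈ Finset.range Q, (1 : ℝ) := Finset.sum_le_sum fun q _ =>
          Set.indicator_le_self' (fun _ _ => zero_le_one) y
      _ = Q := by simp
  have hNm : ∀ Q, Measurable (N Q) := fun Q =>
    Finset.measurable_sum _ fun q _ => measurable_one.indicator (hE q)
  have hNint : ∀ Q, Integrable (N Q) μ := fun Q =>
    integrable_finsetSum _ fun q _ => (integrable_const (1 : ℝ)).indicator (hE q)
  have hsq : ∀ Q, (fun y => N Q y ^ 2) =
      fun y => ∑ q ∈ Finset.range Q, ∑ r ∈ Finset.range Q, (E q ∩ E r).indicator (1 : X → ℝ) y := by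
    intro Q
    funext y
    rw [sq, hN, Finset.sum_mul_sum]
    refine Finset.sum_congr rfl fun q _ => Finset.sum_congr rfl fun r _ => ?_
    rw [Set.inter_indicator_one]; rfl
  have hindint : ∀ {A : Set X}, MeasurableSet A → Integrable (A.indicator (1 : X → ℝ)) μ :=
    fun hA => (integrable_const (1 : ℝ)).indicator hA
  have hN2int : ∀ Q, Integrable (fun y => N Q y ^ 2) μ := by
    intro Q
    rw [hsq]
    exact integrable_finsetSum _ fun q _ => integrable_finsetSum _ fun r _ =>
      hindint ((hE q).inter (hE r))
  have hN2 : ∀ Q, ∫ y, N Q y ^ 2 ∂μ ≤ C * S Q + C * S Q ^ 2 := by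
    intro Q
    rw [hsq, integral_finsetSum _ fun q _ => integrable_finsetSum _ fun r _ =>
      hindint ((hE q).inter (hE r))]
    have e : ∀ q r, ∫ y, (E q ∩ E r).indicator (1 : X → ℝ) y ∂μ = μ.real (E q ∩ E r) :=
      fun q r => integral_indicator_one ((hE q).inter (hE r))
    calc ∑ q ∈ Finset.range Q, ∫ y, ∑ r ∈ Finset.range Q, (E q ∩ E r).indicator (1 : X → ℝ) y ∂μ
        = ∑ q ∈ Finset.range Q, ∑ r ∈ Finset.range Q, μ.real (E q ∩ E r) := by
          refine Finset.sum_congr rfl fun q _ => ?_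
          rw [integral_finsetSum _ fun r _ => hindint ((hE q).inter (hE r))]
          exact Finset.sum_congr rfl fun r _ => e q r
      _ ≤ ∑ q ∈ Finset.range Q, ∑ r ∈ Finset.range Q,
          ((if q = r then C * a q else 0) + C * (a q * a r)) := by
          refine Finset.sum_le_sum fun q _ => Finset.sum_le_sum fun r _ => ?_
          have h4 : 0 ≤ C * (a q * a r) := mul_nonneg hC.le (mul_nonneg (ha q) (ha r))
          by_cases hqr : q = r
          · subst hqr
            rw [Set.inter_self, if_pos rfl]
            linarith [h1 q]
          · rw [if_neg hqr, zero_add]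
            exact h2 q r hqr
      _ = C * S Q + C * S Q ^ 2 := by
          have eS : S Q ^ 2 = ∑ q ∈ Finset.range Q, ∑ r ∈ Finset.range Q, a q * a r := by
            rw [sq, hS, Finset.sum_mul_sum]
          rw [eS]
          simp only [Finset.sum_add_distrib, hS, Finset.mul_sum, Finset.sum_ite_eq]
          congr 1
          exact Finset.sum_congr rfl fun q hq => if_pos hq
  -- the set where at most `K` of the events occur is null
  have hnull : ∀ K : ℕ, μ {y | ∀ Q, N Q y ≤ K} = 0 := by
    intro K
    by_contra hG
    set G := {y | ∀ Q, N Q y ≤ K} with hGdef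
    have hGm : MeasurableSet G := by
      have : G = ⋂ Q, {y | N Q y ≤ K} := by ext; simp [hGdef]
      rw [this]
      exact MeasurableSet.iInter fun Q => measurableSet_le (hNm Q) measurable_const
    have hG0 : 0 < μ.real G := ENNReal.toReal_pos hG (measure_ne_top _ _)
    set m := c * (μ.real G / 2) with hm
    have hm0 : 0 < m := by positivity
    -- Chosen so that C η = m/8. On V \ G the second moment then costs at most m/8 + (m/8 + m/4) S Q
    -- ≤ (m/2) S Q once S Q ≥ 1, half of the linear growth m S Q found on V.
    set η := m / (8 * C) with hη
    have hη0 : 0 < η := by positivity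
    obtain ⟨V, hVm, hVG, hV, hEV⟩ := h3 G hGm hG (m * η) (by positivity)
    obtain ⟨q₀, hq₀⟩ := Filter.eventually_atTop.1 hEV
    obtain ⟨Q, hQ1, hQS, hQ0⟩ := ((hSlim.eventually_ge_atTop 1).and
      ((hSlim.eventually_gt_atTop (4 / m * (m * S q₀ + K * μ.real V))).and
      (Filter.eventually_ge_atTop q₀))).exists
    have hS0 : 0 < S Q := by linarith
    have hq₀S : 0 ≤ S q₀ := Finset.sum_nonneg fun q _ => ha q
    -- lower bound
    have hlow : m * (S Q - S q₀) ≤ ∫ y in V, N Q y ∂μ := by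
      have e : ∫ y in V, N Q y ∂μ = ∑ q ∈ Finset.range Q, μ.real (E q ∩ V) := by
        rw [integral_finsetSum _ fun q _ => (hindint (hE q)).integrableOn]
        refine Finset.sum_congr rfl fun q _ => ?_
        rw [integral_indicator_one (hE q), measureReal_restrict_apply (hE q)]
      rw [e, hS, ← Finset.sum_Ico_eq_sub _ hQ0, Finset.mul_sum]
      calc _ ≤ ∑ q ∈ Finset.Ico q₀ Q, μ.real (E q ∩ V) := by
            refine Finset.sum_le_sum fun q hq => ?_
            refine le_trans ?_ (hq₀ q (Finset.mem_Ico.1 hq).1)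
            have h5 := mul_le_mul_of_nonneg_left hV (mul_nonneg hc.le (ha q))
            calc m * a q = c * a q * (μ.real G / 2) := by rw [hm]; ring
              _ ≤ _ := h5
        _ ≤ _ := Finset.sum_le_sum_of_subset_of_nonneg
            (fun q hq => Finset.mem_range.2 (Finset.mem_Ico.1 hq).2)
            fun _ _ _ => measureReal_nonneg
    -- upper bound
    have hup1 : ∫ y in V ∩ G, N Q y ∂μ ≤ K * μ.real V := by
      calc _ ≤ ∫ y in V ∩ G, (K : ℝ) ∂μ :=
            setIntegral_mono_on (hNint Q).integrableOn (integrable_const _).integrableOn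
              (hVm.inter hGm) fun y hy => hy.2 Q
        _ = μ.real (V ∩ G) * K := by simp
        _ ≤ μ.real V * K := by
            gcongr
            · exact measure_ne_top _ _
            · exact Set.inter_subset_left
        _ = _ := mul_comm _ _
    have hup2 : ∫ y in V \ G, N Q y ∂μ ≤ m / 2 * S Q := by
      -- A weighted AM–GM inequality replaces Cauchy–Schwarz: the first term is controlled by the
      -- second moment, the constant one by the small measure of V \ G.
      have hpt : ∀ y, N Q y ≤ η / S Q * N Q y ^ 2 + S Q / (4 * η) := by
        intro y
        have : 0 ≤ (2 * η * N Q y - S Q) ^ 2 / (4 * η * S Q) := by positivity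
        have e : η / S Q * N Q y ^ 2 + S Q / (4 * η) - N Q y =
            (2 * η * N Q y - S Q) ^ 2 / (4 * η * S Q) := by field_simp; ring
        linarith
      calc _ ≤ ∫ y in V \ G, (η / S Q * N Q y ^ 2 + S Q / (4 * η)) ∂μ :=
            setIntegral_mono (hNint Q).integrableOn
              (((hN2int Q).const_mul _).add (integrable_const _)).integrableOn hpt
        _ = η / S Q * ∫ y in V \ G, N Q y ^ 2 ∂μ + μ.real (V \ G) * (S Q / (4 * η)) := by
            rw [integral_add ((hN2int Q).const_mul _).integrableOn
              (integrable_const _).integrableOn, integral_const_mul]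
            simp
        _ ≤ η / S Q * (C * S Q + C * S Q ^ 2) + (m * η) * (S Q / (4 * η)) := by
            gcongr
            exact (setIntegral_le_integral (hN2int Q)
              (Filter.Eventually.of_forall fun y => sq_nonneg _)).trans (hN2 Q)
        _ = η * C + η * C * S Q + m / 4 * S Q := by field_simp
        _ ≤ _ := by
            have : η * C = m / 8 := by rw [hη]; field_simp
            rw [this]; nlinarith
    have hsplit := integral_inter_add_sdiff hGm (hNint Q).integrableOn (s := V) (μ := μ)
    have : 4 / m * (m * S q₀ + K * μ.real V) * m < S Q * m := by gcongr
    have e : 4 / m * (m * S q₀ + K * μ.real V) * m = 4 * (m * S q₀ + K * μ.real V) := by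
      field_simp
    have : 0 ≤ K * μ.real V := by positivity
    nlinarith
  have hall : ∀ᵐ y ∂μ, ∀ K : ℕ, ¬ ∀ Q, N Q y ≤ K := by
    rw [ae_all_iff]
    intro K
    rw [ae_iff]
    simpa using hnull K
  filter_upwards [hall] with y hy
  by_contra hfin
  rw [Filter.not_frequently, Filter.eventually_atTop] at hfin
  obtain ⟨q₀, hq₀⟩ := hfin
  refine hy q₀ fun Q => ?_
  refine le_trans ?_ (hNle q₀ y)
  calc N Q y ≤ N (max Q q₀) y := Finset.sum_le_sum_of_subset_of_nonneg
        (Finset.range_subset_range.2 (le_max_left _ _))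
        fun q _ _ => Set.indicator_nonneg (fun _ _ => zero_le_one) y
    _ = N q₀ y := by
        symm
        refine Finset.sum_subset (Finset.range_subset_range.2 (le_max_right _ _)) fun q _ hq => ?_
        rw [Finset.mem_range, not_lt] at hq
        exact Set.indicator_of_notMem (hq₀ q hq) _

/-! ### Gallagher's theorem on the unit cube -/

/-- The open unit cube. -/
def openCube (k : ℕ) : Set (Fin k → ℝ) := Set.univ.pi fun _ => Set.Ioo 0 1

lemma isOpen_openCube (k : ℕ) : IsOpen (openCube k) :=
  isOpen_set_pi Set.finite_univ fun _ _ => isOpen_Ioo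

lemma unitCube_eq_Icc (k : ℕ) : unitCube k = Set.Icc 0 1 := by
  ext y; simp [unitCube, Set.mem_Icc, Pi.le_def, forall_and]

lemma openCube_ae_eq (k : ℕ) : openCube k =ᵐ[volume] unitCube k := by
  rw [unitCube_eq_Icc]
  exact Measure.univ_pi_Ioo_ae_eq_Icc (f := fun _ : Fin k => (0 : ℝ)) (g := fun _ => 1)

lemma volume_unitCube_lt_top (k : ℕ) : volume (unitCube k) < ∞ := by
  rw [unitCube_eq_Icc]; exact isCompact_Icc.measure_lt_top

lemma volume_openCube_lt_top (k : ℕ) : volume (openCube k) < ∞ := by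
  rw [measure_congr (openCube_ae_eq k)]; exact volume_unitCube_lt_top k

/-- A measurable set in an open set `O` is approximated by a finite disjoint union of closed balls
in `O`. -/
lemma exists_finite_disjoint_closedBall {k : ℕ} {O G : Set (Fin k → ℝ)} (hO : IsOpen O)
    (hGO : G ⊆ O) (hG0 : volume G ≠ 0) (hGt : volume G ≠ ∞) {ε : ℝ} (hε : 0 < ε)
    (hG : MeasurableSet G) :
    ∃ (F : Finset (Fin k → ℝ)) (r : (Fin k → ℝ) → ℝ), (∀ x ∈ F, 0 < r x) ∧
      (∀ x ∈ F, closedBall x (r x) ⊆ O) ∧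
      ((F : Set (Fin k → ℝ)).PairwiseDisjoint fun x => closedBall x (r x)) ∧
      volume ((⋃ x ∈ F, closedBall x (r x)) \ G) ≤ ENNReal.ofReal ε ∧
      volume G / 2 ≤ volume (⋃ x ∈ F, closedBall x (r x)) := by
  obtain ⟨U, hGU, hU, hUlt⟩ := G.exists_isOpen_lt_add hGt (ENNReal.ofReal_pos.2 hε).ne'
  have hR : ∀ x : Fin k → ℝ, ∃ R : ℝ, x ∈ G → 0 < R ∧ ball x R ⊆ U ∩ O := by
    intro x
    by_cases hx : x ∈ G
    · obtain ⟨R, hR0, hR⟩ := Metric.isOpen_iff.1 (hU.inter hO) x ⟨hGU hx, hGO hx⟩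
      exact ⟨R, fun _ => ⟨hR0, hR⟩⟩
    · exact ⟨0, fun h => (hx h).elim⟩
  choose R hR using hR
  obtain ⟨t, r, htc, htG, hr, hcov, hdisj⟩ :=
    Besicovitch.exists_disjoint_closedBall_covering_ae volume (fun _ => Set.univ) G
      (fun x _ δ hδ => by simpa using hδ) R (fun x hx => (hR x hx).1)
  have hsub : ∀ x ∈ t, closedBall x (r x) ⊆ U ∩ O := fun x hx =>
    (closedBall_subset_ball (hr x hx).2.2).trans (hR x (htG hx)).2
  have hle : volume G ≤ ∑' x : t, volume (closedBall (x : Fin k → ℝ) (r x)) := by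
    rw [← measure_biUnion htc hdisj fun _ _ => isClosed_closedBall.measurableSet]
    calc volume G ≤ volume ((G \ ⋃ x ∈ t, closedBall x (r x)) ∪ ⋃ x ∈ t, closedBall x (r x)) :=
          measure_mono fun y hy => by
            by_cases h : y ∈ ⋃ x ∈ t, closedBall x (r x)
            · exact Or.inr h
            · exact Or.inl ⟨hy, h⟩
      _ ≤ _ := (measure_union_le _ _).trans (by rw [hcov, zero_add])
  have hlt : volume G / 2 < ∑' x : t, volume (closedBall (x : Fin k → ℝ) (r x)) :=
    (ENNReal.half_lt_self hG0 hGt).trans_le hle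
  rw [ENNReal.tsum_eq_iSup_sum] at hlt
  obtain ⟨F, hF⟩ := lt_iSup_iff.1 hlt
  classical
  have hFt : ∀ x ∈ F.image Subtype.val, x ∈ t := by
    intro x hx
    obtain ⟨y, -, rfl⟩ := Finset.mem_image.1 hx
    exact y.2
  have hdisj' : ((F.image Subtype.val : Finset (Fin k → ℝ)) : Set (Fin k → ℝ)).PairwiseDisjoint
      fun x => closedBall x (r x) := hdisj.subset fun x hx => hFt x hx
  refine ⟨F.image Subtype.val, r, fun x hx => (hr x (hFt x hx)).2.1,
    fun x hx => (hsub x (hFt x hx)).trans Set.inter_subset_right, hdisj', ?_, ?_⟩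
  · calc _ ≤ volume (U \ G) := measure_mono (Set.sdiff_subset_sdiff_left
          (Set.iUnion₂_subset fun x hx => (hsub x (hFt x hx)).trans Set.inter_subset_left))
      _ ≤ ENNReal.ofReal ε := by
          rw [measure_sdiff hGU hG.nullMeasurableSet hGt]
          exact tsub_le_iff_left.2 hUlt.le
  · rw [measure_biUnion_finset hdisj' fun _ _ => isClosed_closedBall.measurableSet,
      Finset.sum_image Subtype.val_injective.injOn]
    exact hF.le

lemma ball_bounds_of_subset_openCube {k : ℕ} {x : Fin k → ℝ} {ρ : ℝ} (hρ : 0 < ρ)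
    (h : closedBall x ρ ⊆ openCube k) : (∀ i, 0 ≤ x i - ρ) ∧ ∀ i, x i + ρ ≤ 1 := by
  have h1 : ∀ i, ∀ s : ℝ, |s| ≤ ρ → x i + s ∈ Set.Ioo (0 : ℝ) 1 := by
    intro i s hs
    have h2 : x + Pi.single i s ∈ closedBall x ρ := by
      rw [mem_closedBall, dist_self_add_left]
      rw [pi_norm_le_iff_of_nonneg hρ.le]
      intro j
      by_cases hj : j = i
      · subst hj; simpa using hs
      · simp [hj, hρ.le]
    simpa using h h2 i (Set.mem_univ i)
  exact ⟨fun i => by simpa [sub_eq_add_neg] using (h1 i (-ρ) (by simp [abs_of_pos hρ])).1.le,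
    fun i => (h1 i ρ (by simp [abs_of_pos hρ])).2.le⟩

lemma ae_frequently_mem_nearPrimitive_of_le {k : ℕ} (hk : 2 ≤ k) {t : ℕ → ℝ}
    (ht0 : ∀ q, 0 ≤ t q) (ht : ∀ q, t q ≤ 1 / 4) (hdiv : ¬ Summable fun q => t q ^ k) :
    ∀ᵐ y ∂(volume.restrict (openCube k)), ∃ᶠ q in Filter.atTop,
      y ∈ nearPrimitive k (q + 1) (t (q + 1)) := by
  have hfin : IsFiniteMeasure (volume.restrict (openCube k)) :=
    ⟨by simpa using volume_openCube_lt_top k⟩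
  have hOm := (isOpen_openCube k).measurableSet
  have hle : ∀ (A : Set (Fin k → ℝ)) (b : ℝ), 0 ≤ b → volume A ≤ ENNReal.ofReal b →
      (volume.restrict (openCube k)).real A ≤ b := fun A b hb h =>
    ENNReal.toReal_le_of_le_ofReal hb ((Measure.restrict_apply_le _ _).trans h)
  -- The index is shifted by one to avoid denominator 0.
  refine ae_frequently_mem_of_quasiIndependent (volume.restrict (openCube k))
    (fun q => measurableSet_nearPrimitive k (q + 1) (t (q + 1)))
    (a := fun q => t (q + 1) ^ k) (fun q => pow_nonneg (ht0 _) _)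
    (fun h => hdiv ((summable_nat_add_iff 1).1 h)) (C := 12 ^ k) (c := 1 / 16)
    (by positivity) (by norm_num) ?_ ?_ ?_
  · intro q
    have := pow_nonneg (ht0 (q + 1)) k
    refine hle _ _ (by positivity) ((volume_nearPrimitive_le k q.succ_pos (ht0 _)).trans ?_)
    refine ENNReal.ofReal_le_ofReal (mul_le_mul_of_nonneg_right ?_ this)
    gcongr; norm_num
  · intro q r hqr
    have h1 := pow_nonneg (ht0 (q + 1)) k
    have h2 := pow_nonneg (ht0 (r + 1)) k
    refine hle _ _ (by positivity) ?_
    rw [← mul_assoc]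
    exact volume_nearPrimitive_inter_le q.succ_pos r.succ_pos (by simpa using hqr) (ht0 _) (ht0 _)
  · intro G hG hG0 ε hε
    rw [Measure.restrict_apply hG] at hG0
    have hGt : volume (G ∩ openCube k) ≠ ∞ :=
      ((measure_mono Set.inter_subset_right).trans_lt (volume_openCube_lt_top k)).ne
    obtain ⟨F, r, hr0, hrO, hdisj, h1, h2⟩ := exists_finite_disjoint_closedBall
      (isOpen_openCube k) Set.inter_subset_right hG0 hGt hε (hG.inter hOm)
    set V := ⋃ x ∈ F, closedBall x (r x) with hV
    have hVO : V ⊆ openCube k := Set.iUnion₂_subset hrO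
    have hVm : MeasurableSet V :=
      Finset.measurableSet_biUnion _ fun _ _ => isClosed_closedBall.measurableSet
    have hVt : volume V ≠ ∞ := ((measure_mono hVO).trans_lt (volume_openCube_lt_top k)).ne
    refine ⟨V, hVm, ?_, ?_, ?_⟩
    · refine hle _ _ hε.le (le_trans (measure_mono ?_) h1) |>.trans le_rfl
      exact fun y hy => ⟨hy.1, fun h => hy.2 h.1⟩
    · simp only [Measure.real, Measure.restrict_apply hG, Measure.restrict_apply hVm,
        Set.inter_eq_left.2 hVO]
      have := ENNReal.toReal_mono hVt h2
      simpa using this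
    · have h3 : ∀ x ∈ F, ∀ᶠ q : ℕ in Filter.atTop,
          ENNReal.ofReal (t (q + 1) ^ k / 16) * volume (closedBall x (r x)) ≤
          volume (nearPrimitive k (q + 1) (t (q + 1)) ∩ closedBall x (r x)) := fun x hx =>
        (Filter.tendsto_add_atTop_nat 1).eventually
          (eventually_le_volume_nearPrimitive_inter hk ht0 ht (hr0 x hx)
            (ball_bounds_of_subset_openCube (hr0 x hx) (hrO x hx)).1
            (ball_bounds_of_subset_openCube (hr0 x hx) (hrO x hx)).2)
      filter_upwards [(Filter.eventually_all_finset F).2 h3] with q hq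
      have hEm := measurableSet_nearPrimitive k (q + 1) (t (q + 1))
      have h4 : ENNReal.ofReal (t (q + 1) ^ k / 16) * volume V ≤
          volume (nearPrimitive k (q + 1) (t (q + 1)) ∩ V) := by
        rw [hV, Set.inter_iUnion₂,
          measure_biUnion_finset hdisj fun _ _ => isClosed_closedBall.measurableSet,
          measure_biUnion_finset
            (fun x hx y hy hxy => (hdisj hx hy hxy).mono Set.inter_subset_right
              Set.inter_subset_right)
            fun _ _ => hEm.inter isClosed_closedBall.measurableSet, Finset.mul_sum]
        exact Finset.sum_le_sum hq
      simp only [Measure.real, Measure.restrict_apply (hEm.inter hVm), Measure.restrict_apply hVm,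
        Set.inter_eq_left.2 hVO, Set.inter_eq_left.2 (Set.inter_subset_right.trans hVO)]
      have h5 := ENNReal.toReal_mono
        (measure_ne_top_of_subset Set.inter_subset_right hVt) h4
      rw [ENNReal.toReal_mul, ENNReal.toReal_ofReal (by have := ht0 (q + 1); positivity)] at h5
      refine le_trans (le_of_eq ?_) h5
      ring

lemma nearPrimitive_mono (k q : ℕ) {t u : ℝ} (h : t ≤ u) :
    nearPrimitive k q t ⊆ nearPrimitive k q u :=
  Set.iUnion₂_mono fun _ _ => closedBall_subset_closedBall (by gcongr)

/-- If the truncated series converged, its terms would tend to 0, so the truncation would eventually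
be inactive. -/
lemma not_summable_min_pow {k : ℕ} {t : ℕ → ℝ} {b : ℝ} (hb : 0 < b)
    (hdiv : ¬ Summable fun q => t q ^ k) : ¬ Summable fun q => (min (t q) b) ^ k := by
  intro h
  refine hdiv ((summable_congr_atTop ?_).1 h)
  have h1 := h.tendsto_atTop_zero.eventually_lt_const (show 0 < b ^ k by positivity)
  filter_upwards [h1] with q hq
  have h2 : min (t q) b < b := lt_of_pow_lt_pow_left₀ k hb.le hq
  rw [min_eq_left]
  by_contra hcon
  rw [min_eq_right (not_le.1 hcon).le] at h2
  exact lt_irrefl _ h2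

/-- Gallagher's theorem: in dimension `k ≥ 2`, if `∑ t(q)ᵏ = ∞` then almost every point of the unit
cube is within `t(q) / q` of a primitive point of denominator `q`, for infinitely many `q`. -/
theorem ae_exists_mem_nearPrimitive {k : ℕ} (hk : 2 ≤ k) {t : ℕ → ℝ} (ht0 : ∀ q, 0 ≤ t q)
    (hdiv : ¬ Summable fun q => t q ^ k) :
    ∀ᵐ y ∂(volume.restrict (unitCube k)), ∀ n : ℕ, ∃ q, n < q ∧ y ∈ nearPrimitive k q (t q) := by
  rw [← Measure.restrict_congr_set (openCube_ae_eq k)]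
  filter_upwards [ae_frequently_mem_nearPrimitive_of_le hk (t := fun q => min (t q) (1 / 4))
    (fun q => le_min (ht0 q) (by norm_num)) (fun q => min_le_right _ _)
    (not_summable_min_pow (by norm_num) hdiv)] with y hy n
  obtain ⟨q, hq, hqy⟩ := Filter.frequently_atTop.1 hy n
  exact ⟨q + 1, Nat.lt_succ_of_le hq, nearPrimitive_mono _ _ (min_le_left _ _) hqy⟩

/-! ### Layered packings of balls -/

section Packing

variable {k : ℕ} {ι : Type*} {x : ι → Fin k → ℝ} {R : ι → ℝ}

/-- The total content of disjoint balls inside a ball. -/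
lemma sum_pow_le_of_disjoint {S : Finset ι} (hR : ∀ i ∈ S, 0 ≤ R i)
    (hdisj : (S : Set ι).PairwiseDisjoint fun i => closedBall (x i) (R i)) {z : Fin k → ℝ} {a : ℝ}
    (ha : 0 ≤ a) (hsub : ∀ i ∈ S, closedBall (x i) (R i) ⊆ closedBall z a) :
    ∑ i ∈ S, R i ^ k ≤ a ^ k := by
  have h1 : ∑ i ∈ S, volume (closedBall (x i) (R i)) ≤ volume (closedBall z a) := by
    rw [← measure_biUnion_finset hdisj fun _ _ => isClosed_closedBall.measurableSet]
    exact measure_mono (Set.iUnion₂_subset hsub)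
  rw [Real.volume_pi_closedBall _ ha, Finset.sum_congr rfl fun i hi =>
    Real.volume_pi_closedBall (x i) (hR i hi), ← ENNReal.ofReal_sum_of_nonneg
    (fun i hi => by have := hR i hi; positivity), ENNReal.ofReal_le_ofReal_iff (by positivity),
    Fintype.card_fin] at h1
  simp only [mul_pow, ← Finset.mul_sum] at h1
  exact le_of_mul_le_mul_left h1 (by positivity)

/-- A Vitali-type selection: if almost every point of a ball lies in arbitrarily late balls of a
family, a finite disjoint subfamily avoiding a small closed set fills a fixed proportion. -/
lemma exists_disjoint_layer [Countable ι] {lev : ι → ℕ} (hR : ∀ i, 0 ≤ R i)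
    (hR0 : ∀ ε : ℝ, 0 < ε → ∃ n, ∀ i, n ≤ lev i → R i < ε)
    {x₀ : Fin k → ℝ} {r₀ : ℝ} (hr₀ : 0 < r₀)
    (hae : ∀ᵐ y ∂(volume.restrict (closedBall x₀ r₀)), ∀ n, ∃ i, n ≤ lev i ∧
      y ∈ closedBall (x i) (R i))
    {Z : Set (Fin k → ℝ)} (hZ : IsClosed Z) (hZv : volume Z ≤ ENNReal.ofReal (r₀ ^ k / 2))
    (n₀ : ℕ) :
    ∃ S : Finset ι, (∀ i ∈ S, n₀ ≤ lev i) ∧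
      (∀ i ∈ S, closedBall (x i) (R i) ⊆ closedBall x₀ r₀ \ Z) ∧
      ((S : Set ι).PairwiseDisjoint fun i => closedBall (x i) (R i)) ∧
      r₀ ^ k / (4 * 10 ^ k) ≤ ∑ i ∈ S, R i ^ k := by
  set U := ball x₀ r₀ \ Z with hU
  have hUo : IsOpen U := isOpen_ball.sdiff hZ
  obtain ⟨n₁, hn₁⟩ := hR0 1 one_pos
  set t : Set ι := {i | max n₀ n₁ ≤ lev i ∧ closedBall (x i) (R i) ⊆ U} with ht
  obtain ⟨u, hut, hdisj, hcov⟩ := Vitali.exists_disjoint_subfamily_covering_enlargement_closedBall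
    t x R 1 (fun i hi => (hn₁ i ((le_max_right _ _).trans hi.1)).le) 5 (by norm_num)
  have hUae : ∀ᵐ y ∂(volume.restrict U), y ∈ ⋃ i ∈ u, closedBall (x i) (5 * R i) := by
    have h1 := ae_restrict_of_ae_restrict_of_subset
      (Set.sdiff_subset.trans ball_subset_closedBall : U ⊆ closedBall x₀ r₀) hae
    filter_upwards [h1, ae_restrict_mem hUo.measurableSet] with y hy hyU
    obtain ⟨ε, hε, hεU⟩ := Metric.isOpen_iff.1 hUo y hyU
    obtain ⟨n₂, hn₂⟩ := hR0 (ε / 2) (by positivity)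
    obtain ⟨i, hi, hyi⟩ := hy (max (max n₀ n₁) n₂)
    have hit : i ∈ t := by
      refine ⟨(le_max_left _ _).trans hi, fun w hw => hεU ?_⟩
      have h2 := hn₂ i ((le_max_right _ _).trans hi)
      rw [mem_closedBall] at hw hyi
      have := dist_triangle_right w y (x i)
      rw [mem_ball]; linarith
    obtain ⟨b, hb, hsub⟩ := hcov i hit
    exact Set.mem_biUnion hb (hsub hyi)
  have hUv : ENNReal.ofReal (r₀ ^ k / 2) ≤ volume U := by
    have h1 : volume (ball x₀ r₀) ≤ volume U + volume Z :=
      (measure_mono (by rw [hU, Set.sdiff_union_self]; exact Set.subset_union_left)).trans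
        (measure_union_le _ _)
    rw [Real.volume_pi_ball _ hr₀, Fintype.card_fin] at h1
    have h2 : ENNReal.ofReal (r₀ ^ k / 2) + ENNReal.ofReal (r₀ ^ k / 2) ≤
        volume U + ENNReal.ofReal (r₀ ^ k / 2) := by
      rw [← ENNReal.ofReal_add (by positivity) (by positivity), add_halves]
      refine le_trans (ENNReal.ofReal_le_ofReal ?_) (h1.trans (by gcongr))
      gcongr; linarith
    exact (ENNReal.add_le_add_iff_right ENNReal.ofReal_ne_top).1 h2
  have hsum : ENNReal.ofReal (r₀ ^ k / 2) ≤ ∑' i : u, ENNReal.ofReal ((10 * R i) ^ k) := by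
    calc _ ≤ volume U := hUv
      _ ≤ volume (⋃ i ∈ u, closedBall (x i) (5 * R i)) :=
          measure_mono_ae ((ae_restrict_iff' hUo.measurableSet).1 hUae)
      _ ≤ ∑' i : u, volume (closedBall (x i) (5 * R i)) := measure_biUnion_le _ u.to_countable _
      _ = _ := by
          refine tsum_congr fun i => ?_
          rw [Real.volume_pi_closedBall _ (by have := hR i; positivity), Fintype.card_fin]
          congr 2; ring
  -- Another factor 2 is given up to get a strict inequality, so that a finite subfamily suffices.
  have hlt : ENNReal.ofReal (r₀ ^ k / 4) < ∑' i : u, ENNReal.ofReal ((10 * R i) ^ k) := by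
    refine lt_of_lt_of_le ((ENNReal.ofReal_lt_ofReal_iff (by positivity)).2 ?_) hsum
    have : 0 < r₀ ^ k := by positivity
    linarith
  rw [ENNReal.tsum_eq_iSup_sum] at hlt
  obtain ⟨F, hF⟩ := lt_iSup_iff.1 hlt
  classical
  have hFu : ∀ i ∈ F.image Subtype.val, i ∈ u := by
    intro i hi
    obtain ⟨y, -, rfl⟩ := Finset.mem_image.1 hi
    exact y.2
  refine ⟨F.image Subtype.val, fun i hi => (le_max_left _ _).trans (hut (hFu i hi)).1,
    fun i hi => (hut (hFu i hi)).2.trans (Set.sdiff_subset_sdiff_left ball_subset_closedBall),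
    hdisj.subset fun i hi => hFu i hi, ?_⟩
  rw [Finset.sum_image Subtype.val_injective.injOn]
  rw [← ENNReal.ofReal_sum_of_nonneg (fun i _ => by have := hR i; positivity)] at hF
  have h3 := (ENNReal.ofReal_lt_ofReal_iff_of_nonneg (by positivity)).1 hF
  simp only [mul_pow, ← Finset.mul_sum] at h3
  rw [div_le_iff₀ (by positivity)]
  linarith

/-- A finite family of balls of radii `r i`, surrounded by larger balls of radii `R i` and arranged
in `L` layers: within a layer the large balls are disjoint, and the large balls of a layer avoid
the balls of the preceding layers and are of much smaller content. -/
structure IsLayered (x : ι → Fin k → ℝ) (r : ι → ℝ≥0) (R : ι → ℝ) (L : ℕ) (T : Finset ι)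
    (layer : ι → ℕ) : Prop where
  two_mul_le : ∀ i ∈ T, 2 * (r i : ℝ) ≤ R i
  separated : ∀ i ∈ T, ∀ j ∈ T, i ≠ j → layer i = layer j → R i + R j < dist (x i) (x j)
  avoid : ∀ i ∈ T, ∀ j ∈ T, layer i < layer j → 2 * (r i : ℝ) + R j < dist (x i) (x j)
  decay : ∀ i ∈ T, ∀ j ∈ T, layer i < layer j → L * R j ^ k ≤ R i ^ k

/-- A ball meeting two members of a layered family meets members of small total content. -/
lemma IsLayered.sum_hit_le {r : ι → ℝ≥0} {L : ℕ} {T : Finset ι} {layer : ι → ℕ}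
    (h : IsLayered x r R L T layer) (hL : ∀ i ∈ T, layer i < L) {z : Fin k → ℝ} {a b : ℝ}
    (ha : 0 ≤ a) (hb : ∀ i ∈ T, (r i : ℝ) ≤ 2 * a → R i ^ k ≤ b)
    {H : Finset ι} (hHT : H ⊆ T)
    (hH : ∀ i ∈ H, (closedBall (x i) (r i) ∩ closedBall z a).Nonempty)
    {i₀ j₀ : ι} (hi₀ : i₀ ∈ H) (hj₀ : j₀ ∈ H) (hij : i₀ ≠ j₀) :
    ∑ i ∈ H, R i ^ k ≤ L * (7 * a) ^ k + 2 * b := by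
  classical
  have hL0 : (1 : ℝ) ≤ L := by
    have := hL i₀ (hHT hi₀)
    exact_mod_cast (by omega : 1 ≤ L)
  have hR : ∀ i ∈ T, 0 ≤ R i := fun i hi =>
    (by positivity : (0 : ℝ) ≤ 2 * r i).trans (h.two_mul_le i hi)
  have hdz : ∀ i ∈ H, dist (x i) z ≤ r i + a := by
    intro i hi
    obtain ⟨y, hy1, hy2⟩ := hH i hi
    rw [mem_closedBall] at hy1 hy2
    have := dist_triangle_left (x i) z y
    linarith
  have hdd : ∀ i ∈ H, ∀ j ∈ H, dist (x i) (x j) ≤ r i + r j + 2 * a := by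
    intro i hi j hj
    have := dist_triangle_right (x i) (x j) z
    linarith [hdz i hi, hdz j hj]
  -- Separation gives R i + R j < r i + r j + 2a ≤ (R i + R j)/2 + 2a: two members of one layer are
  -- both met only if both are small.
  have hsame : ∀ i ∈ H, ∀ j ∈ H, i ≠ j → layer i = layer j → R i < 4 * a := by
    intro i hi j hj hne hl
    have h1 := h.separated i (hHT hi) j (hHT hj) hne hl
    linarith [hdd i hi j hj, h.two_mul_le i (hHT hi), h.two_mul_le j (hHT hj), hR j (hHT hj)]
  -- If a later member is also met, avoidance forces r i ≤ 2a.
  have hearly : ∀ i ∈ H, ∀ j ∈ H, layer i < layer j → R i ^ k ≤ b := by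
    intro i hi j hj hl
    refine hb i (hHT hi) ?_
    have h1 := h.avoid i (hHT hi) j (hHT hj) hl
    have : (0 : ℝ) ≤ r j := (r j).2
    linarith [hdd i hi j hj, h.two_mul_le j (hHT hj)]
  have hpow : ∀ i ∈ T, 0 ≤ R i ^ k := fun i hi => pow_nonneg (hR i hi) k
  have hlayer : ∀ i ∈ H, ¬ R i < 4 * a → ∀ j ∈ H, i ≠ j → layer i ≠ layer j :=
    fun i hi hlarge j hj hne hl => hlarge (hsame i hi j hj hne hl)
  have hlarge : ∀ i ∈ H, ¬ R i < 4 * a → R i ^ k ≤ b := by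
    intro i hi hl
    obtain ⟨j, hj, hne⟩ : ∃ j ∈ H, i ≠ j := by
      by_cases hc : i = i₀
      · exact ⟨j₀, hj₀, hc ▸ hij⟩
      · exact ⟨i₀, hi₀, hc⟩
    rcases lt_or_gt_of_ne (hlayer i hi hl j hj hne) with h1 | h1
    · exact hearly i hi j hj h1
    · refine le_trans ?_ (hearly j hj i hi h1)
      refine le_trans ?_ (h.decay j (hHT hj) i (hHT hi) h1)
      exact le_mul_of_one_le_left (hpow i (hHT hi)) hL0
  rw [← Finset.sum_filter_add_sum_filter_not H (fun i => R i < 4 * a)]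
  refine add_le_add ?_ ?_
  · rw [← Finset.sum_fiberwise_of_maps_to (g := layer) (t := Finset.range L)
      (fun i hi => Finset.mem_range.2 (hL i (hHT (Finset.mem_filter.1 hi).1)))]
    -- Here dist (x i) z ≤ R i / 2 + a and R i < 4a, so the large balls lie in the ball of radius
    -- 7a; they are disjoint within a layer.
    calc _ ≤ ∑ l ∈ Finset.range L, (7 * a) ^ k := by
          refine Finset.sum_le_sum fun l _ => ?_
          have hmem : ∀ i ∈ (H.filter fun i => R i < 4 * a).filter fun i => layer i = l,
              i ∈ H ∧ R i < 4 * a ∧ layer i = l := fun i hi => by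
            simpa [and_assoc] using hi
          refine sum_pow_le_of_disjoint (x := x) (z := z)
            (fun i hi => hR i (hHT (hmem i hi).1)) ?_ (by positivity) ?_
          · intro i hi j hj hne
            refine closedBall_disjoint_closedBall ?_
            exact h.separated i (hHT (hmem i hi).1) j (hHT (hmem j hj).1) hne
              ((hmem i hi).2.2.trans (hmem j hj).2.2.symm)
          · intro i hi
            refine closedBall_subset_closedBall' ?_
            linarith [hdz i (hmem i hi).1, (hmem i hi).2.1, h.two_mul_le i (hHT (hmem i hi).1)]
      _ = _ := by simp
  · set B := H.filter fun i => ¬ R i < 4 * a with hB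
    have hBm : ∀ i ∈ B, i ∈ H ∧ ¬ R i < 4 * a := fun i hi => Finset.mem_filter.1 hi
    have hb0 : 0 ≤ b := by
      by_cases hl : layer i₀ = layer j₀
      · refine (hpow i₀ (hHT hi₀)).trans (hb i₀ (hHT hi₀) ?_)
        linarith [hsame i₀ hi₀ j₀ hj₀ hij hl, h.two_mul_le i₀ (hHT hi₀)]
      · rcases lt_or_gt_of_ne hl with h1 | h1
        · exact (hpow i₀ (hHT hi₀)).trans (hearly i₀ hi₀ j₀ hj₀ h1)
        · exact (hpow j₀ (hHT hj₀)).trans (hearly j₀ hj₀ i₀ hi₀ h1)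
    rcases B.eq_empty_or_nonempty with hBe | hBne
    · rw [hBe]; simp [hb0]
    obtain ⟨i₁, hi₁, hmin⟩ := Finset.exists_min_image B layer hBne
    have hcard : (B.card : ℝ) ≤ L := by
      have : B.card ≤ (Finset.range L).card :=
        Finset.card_le_card_of_injOn layer
          (fun i hi => Finset.mem_coe.2 (Finset.mem_range.2 (hL i (hHT (hBm i hi).1))))
          (fun i hi j hj hl => by
            by_contra hne
            exact hlayer i (hBm i hi).1 (hBm i hi).2 j (hBm j hj).1 hne hl)
      rw [Finset.card_range] at this
      exact_mod_cast this
    rw [← Finset.add_sum_erase B _ hi₁, two_mul]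
    refine add_le_add (hlarge i₁ (hBm i₁ hi₁).1 (hBm i₁ hi₁).2) ?_
    -- Members with R ≥ 4a lie in distinct layers, so they number at most L. Decay relative to the
    -- earliest one bounds the rest by b / L each, hence by b in all.
    have h1 : ∀ i ∈ B.erase i₁, R i ^ k ≤ b / L := by
      intro i hi
      obtain ⟨hne, hiB⟩ := Finset.mem_erase.1 hi
      rw [le_div_iff₀ (by linarith), mul_comm]
      refine (h.decay i₁ (hHT (hBm i₁ hi₁).1) i (hHT (hBm i hiB).1) ?_).trans
        (hlarge i₁ (hBm i₁ hi₁).1 (hBm i₁ hi₁).2)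
      exact lt_of_le_of_ne (hmin i hiB)
        (hlayer i₁ (hBm i₁ hi₁).1 (hBm i₁ hi₁).2 i (hBm i hiB).1 hne.symm)
    calc ∑ i ∈ B.erase i₁, R i ^ k ≤ (B.erase i₁).card • (b / L) := Finset.sum_le_card_nsmul _ _ _ h1
      _ ≤ L * (b / L) := by
          rw [nsmul_eq_mul]
          gcongr
          exact Finset.card_erase_le.trans (by exact_mod_cast hcard)
      _ = b := by field_simp

/-- Layered families of prescribed height inside a ball. -/
lemma exists_isLayered [Countable ι] {r : ι → ℝ≥0} {lev : ι → ℕ}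
    (hRpos : ∀ i, 0 < R i)
    (hR0 : ∀ ε : ℝ, 0 < ε → ∃ n, ∀ i, n ≤ lev i → R i < ε)
    (hrR : ∀ K : ℝ, ∃ n, ∀ i, n ≤ lev i → K * (r i : ℝ) ^ k ≤ R i ^ k)
    (hk : k ≠ 0) {x₀ : Fin k → ℝ} {r₀ : ℝ} (hr₀ : 0 < r₀)
    (hae : ∀ᵐ y ∂(volume.restrict (closedBall x₀ r₀)), ∀ n, ∃ i, n ≤ lev i ∧
      y ∈ closedBall (x i) (R i))
    {L : ℕ} (hL : 0 < L) (n₀ : ℕ) {m : ℕ} (hm : m ≤ L) :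
    ∃ (T : Finset ι) (layer : ι → ℕ), IsLayered x r R L T layer ∧ (∀ i ∈ T, layer i < m) ∧
      (∀ i ∈ T, n₀ ≤ lev i) ∧ (∀ i ∈ T, closedBall (x i) (R i) ⊆ closedBall x₀ r₀) ∧
      (∀ i ∈ T, 2 * L * (4 * (r i : ℝ)) ^ k ≤ R i ^ k) ∧
      ∑ i ∈ T, R i ^ k ≤ m * r₀ ^ k ∧
      m * (r₀ ^ k / (4 * 10 ^ k)) ≤ ∑ i ∈ T, R i ^ k := by
  classical
  induction m with
  | zero =>
    exact ⟨∅, fun _ => 0, ⟨by simp, by simp, by simp, by simp⟩, by simp, by simp, by simp, by simp,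
      by simp, by simp⟩
  | succ m ih =>
    obtain ⟨T, layer, hT, hlay, hlev, hsub, hsmall, hup, hlow⟩ := ih (by omega)
    have hLR : (0 : ℝ) < L := by exact_mod_cast hL
    set Z := ⋃ i ∈ T, closedBall (x i) (2 * r i) with hZ
    have hZc : IsClosed Z := isClosed_biUnion_finset fun _ _ => isClosed_closedBall
    have hZv : volume Z ≤ ENNReal.ofReal (r₀ ^ k / 2) := by
      calc volume Z ≤ ∑ i ∈ T, volume (closedBall (x i) (2 * r i)) := measure_biUnion_finset_le _ _
        _ = ∑ i ∈ T, ENNReal.ofReal ((4 * (r i : ℝ)) ^ k) := by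
            refine Finset.sum_congr rfl fun i _ => ?_
            rw [Real.volume_pi_closedBall _ (by positivity), Fintype.card_fin]
            congr 2; ring
        _ = ENNReal.ofReal (∑ i ∈ T, (4 * (r i : ℝ)) ^ k) :=
            (ENNReal.ofReal_sum_of_nonneg fun _ _ => by positivity).symm
        _ ≤ _ := by
            refine ENNReal.ofReal_le_ofReal ?_
            -- The smallness of r relative to R keeps the doubled small balls of all the layers
            -- built so far within volume r₀ᵏ/2, leaving room for a new layer.
            have h1 : 2 * L * ∑ i ∈ T, (4 * (r i : ℝ)) ^ k ≤ m * r₀ ^ k := by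
              rw [Finset.mul_sum]
              exact (Finset.sum_le_sum hsmall).trans hup
            have h2 : (m : ℝ) * r₀ ^ k ≤ L * r₀ ^ k := by
              gcongr; exact_mod_cast (by omega : m ≤ L)
            rw [le_div_iff₀ two_pos]
            refine le_of_mul_le_mul_left ?_ hLR
            linarith
    -- the new layer is of much smaller content than each member of `T`
    obtain ⟨ε, hε, hεT⟩ : ∃ ε : ℝ, 0 < ε ∧ ∀ i ∈ T, ε ≤ R i ^ k := by
      rcases T.eq_empty_or_nonempty with hTe | hTne
      · exact ⟨1, one_pos, by simp [hTe]⟩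
      · obtain ⟨i, hi, hmin⟩ := Finset.exists_min_image T (fun i => R i ^ k) hTne
        exact ⟨R i ^ k, pow_pos (hRpos i) k, hmin⟩
    obtain ⟨n₁, hn₁⟩ := hR0 (min 1 (ε / L)) (lt_min one_pos (by positivity))
    obtain ⟨n₂, hn₂⟩ := hrR (2 * L * 4 ^ k)
    obtain ⟨S, hSlev, hSsub, hSdisj, hSsum⟩ := exists_disjoint_layer (fun i => (hRpos i).le) hR0 hr₀
      hae hZc hZv (max n₀ (max n₁ n₂))
    have hSlev0 : ∀ i ∈ S, n₀ ≤ lev i := fun i hi => (le_max_left _ _).trans (hSlev i hi)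
    have hSε : ∀ i ∈ S, L * R i ^ k ≤ ε := by
      intro i hi
      have h1 := hn₁ i (((le_max_left _ _).trans (le_max_right _ _)).trans (hSlev i hi))
      have h2 : R i ^ k ≤ R i :=
        pow_le_of_le_one (hRpos i).le (h1.le.trans (min_le_left _ _)) hk
      have h3 : R i ≤ ε / L := h1.le.trans (min_le_right _ _)
      rw [le_div_iff₀ hLR] at h3
      nlinarith
    have hSsmall : ∀ i ∈ S, 2 * L * (4 * (r i : ℝ)) ^ k ≤ R i ^ k := by
      intro i hi
      have h1 := hn₂ i (((le_max_right _ _).trans (le_max_right _ _)).trans (hSlev i hi))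
      rw [mul_pow, ← mul_assoc]; exact h1
    have hSZ : ∀ i ∈ T, ∀ j ∈ S, 2 * (r i : ℝ) + R j < dist (x i) (x j) := by
      intro i hi j hj
      refine (disjoint_closedBall_closedBall_iff (by positivity) (hRpos j).le).1 ?_
      refine Set.disjoint_left.2 fun y hy1 hy2 => (hSsub j hj hy2).2 ?_
      exact Set.mem_biUnion (t := fun i => closedBall (x i) (2 * r i)) hi hy1
    have hST : ∀ j ∈ S, j ∉ T := by
      intro j hj hjT
      have := hSZ j hjT j hj
      rw [dist_self] at this
      linarith [hRpos j, (r j).2, show (0 : ℝ) ≤ r j from (r j).2]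
    have hdisj : Disjoint T S := Finset.disjoint_left.2 fun i hi hi' => hST i hi' hi
    set layer' : ι → ℕ := fun i => if i ∈ T then layer i else m with hlayer'
    have hl1 : ∀ i ∈ T, layer' i = layer i := fun i hi => if_pos hi
    have hl2 : ∀ i ∈ S, layer' i = m := fun i hi => if_neg (hST i hi)
    have hSup : ∑ i ∈ S, R i ^ k ≤ r₀ ^ k :=
      sum_pow_le_of_disjoint (fun i _ => (hRpos i).le) hSdisj hr₀.le
        fun i hi => (hSsub i hi).trans Set.sdiff_subset
    refine ⟨T ∪ S, layer', ⟨?_, ?_, ?_, ?_⟩, ?_, ?_, ?_, ?_, ?_, ?_⟩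
    · intro i hi
      rcases Finset.mem_union.1 hi with hi | hi
      · exact hT.two_mul_le i hi
      · refine le_of_pow_le_pow_left₀ hk (hRpos i).le (le_trans ?_ (hSsmall i hi))
        have h1 : (1 : ℝ) ≤ L := by exact_mod_cast hL
        calc (2 * (r i : ℝ)) ^ k ≤ (4 * (r i : ℝ)) ^ k := by
              gcongr; norm_num
          _ ≤ _ := le_mul_of_one_le_left (by positivity) (by linarith)
    · intro i hi j hj hne hl
      rcases Finset.mem_union.1 hi with hi | hi <;> rcases Finset.mem_union.1 hj with hj | hj
      · rw [hl1 i hi, hl1 j hj] at hl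
        exact hT.separated i hi j hj hne hl
      · rw [hl1 i hi, hl2 j hj] at hl
        exact absurd hl (hlay i hi).ne
      · rw [hl2 i hi, hl1 j hj] at hl
        exact absurd hl.symm (hlay j hj).ne
      · exact (disjoint_closedBall_closedBall_iff (hRpos i).le (hRpos j).le).1
          (hSdisj hi hj hne)
    · intro i hi j hj hl
      rcases Finset.mem_union.1 hi with hi | hi <;> rcases Finset.mem_union.1 hj with hj | hj
      · rw [hl1 i hi, hl1 j hj] at hl
        exact hT.avoid i hi j hj hl
      · exact hSZ i hi j hj
      · rw [hl2 i hi, hl1 j hj] at hl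
        exact absurd hl (hlay j hj).not_gt
      · rw [hl2 i hi, hl2 j hj] at hl
        exact absurd hl (lt_irrefl _)
    · intro i hi j hj hl
      rcases Finset.mem_union.1 hi with hi | hi <;> rcases Finset.mem_union.1 hj with hj | hj
      · rw [hl1 i hi, hl1 j hj] at hl
        exact hT.decay i hi j hj hl
      · exact (hSε j hj).trans (hεT i hi)
      · rw [hl2 i hi, hl1 j hj] at hl
        exact absurd hl (hlay j hj).not_gt
      · rw [hl2 i hi, hl2 j hj] at hl
        exact absurd hl (lt_irrefl _)
    · intro i hi
      rcases Finset.mem_union.1 hi with hi | hi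
      · rw [hl1 i hi]; exact (hlay i hi).trans (Nat.lt_succ_self m)
      · rw [hl2 i hi]; exact Nat.lt_succ_self m
    · intro i hi
      exact (Finset.mem_union.1 hi).elim (hlev i) (hSlev0 i)
    · intro i hi
      exact (Finset.mem_union.1 hi).elim (hsub i) fun hi => (hSsub i hi).trans Set.sdiff_subset
    · intro i hi
      exact (Finset.mem_union.1 hi).elim (hsmall i) (hSsmall i)
    · rw [Finset.sum_union hdisj]; push_cast; linarith
    · rw [Finset.sum_union hdisj]; push_cast; linarith

end Packing

/-! ### Mass transference against a fixed cover -/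

section Transference

variable {k : ℕ} {f : ℝ≥0 → ℝ≥0}

/-- The part of the cost of a cover that is carried by the members meeting `D`. -/
noncomputable def hitCost {X : Type*} [MetricSpace X] (f : ℝ≥0 → ℝ≥0) (s : Set (X × ℝ≥0))
    (D : Set X) : ℝ≥0∞ :=
  ∑' b : s, {b : X × ℝ≥0 | (D ∩ closedBall b.1 b.2).Nonempty}.indicator
    (fun b => (f b.2 : ℝ≥0∞)) b

lemma hitCost_le_tsum {X : Type*} [MetricSpace X] (f : ℝ≥0 → ℝ≥0) (s : Set (X × ℝ≥0))
    (D : Set X) : hitCost f s D ≤ ∑' b : s, (f b.1.2 : ℝ≥0∞) :=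
  ENNReal.tsum_le_tsum fun _ => Set.indicator_le_self _ _ _

lemma le_hitCost {X : Type*} [MetricSpace X] (f : ℝ≥0 → ℝ≥0) {s : Set (X × ℝ≥0)}
    {D : Set X} {b : X × ℝ≥0} (hb : b ∈ s) (h : (D ∩ closedBall b.1 b.2).Nonempty) :
    (f b.2 : ℝ≥0∞) ≤ hitCost f s D := by
  refine le_trans (le_of_eq ?_) (ENNReal.le_tsum (⟨b, hb⟩ : s))
  exact (Set.indicator_of_mem (show b ∈ {b : X × ℝ≥0 | (D ∩ closedBall b.1 b.2).Nonempty} from h)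
    (fun b => (f b.2 : ℝ≥0∞))).symm

/-- The constant bounding the content of the members of a layered family met by one ball. -/
noncomputable def hitConst (k : ℕ) : ℝ := (8 * 10 ^ k + 1) * 7 ^ k + 2 * 2 ^ k

lemma one_le_hitConst (k : ℕ) : 1 ≤ hitConst k := by
  have h1 : (1 : ℝ) ≤ 7 ^ k := one_le_pow₀ (by norm_num)
  have h2 : (0 : ℝ) < 10 ^ k := by positivity
  have h3 : (0 : ℝ) < 2 ^ k := by positivity
  rw [hitConst]; nlinarith

/-- If the members of a family with enough content are met by a cheap cover, each member that is
met by a ball meeting two of them being charged to that ball, some member is met by a cheap part of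
the cover. -/
lemma exists_hitCost_lt {X : Type*} [MetricSpace X] {ι : Type*} {s : Set (X × ℝ≥0)}
    {D : Set X} {B : ι → Set X} {w : ι → ℝ≥0} {T : Finset ι} {C H : ℝ≥0} (hC : 0 < C)
    (hBD : ∀ i ∈ T, B i ⊆ D) (hcost : hitCost f s D < (C⁻¹ * H : ℝ≥0))
    (hmulti : ∀ b ∈ s, ∀ K ⊆ T, (∀ i ∈ K, (B i ∩ closedBall b.1 b.2).Nonempty) →
      (∃ i ∈ K, ∃ j ∈ K, i ≠ j) → ∑ i ∈ K, w i ≤ C * f b.2)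
    (hW : 2 * H ≤ ∑ i ∈ T, w i) :
    ∃ i ∈ T, hitCost f s (B i) < (C⁻¹ * w i : ℝ≥0) := by
  classical
  by_contra! hcon
  set hit : s → ι → Prop := fun b i => (B i ∩ closedBall b.1.1 b.1.2).Nonempty with hhit
  set multi : s → Prop := fun b => ∃ i ∈ T, ∃ j ∈ T, i ≠ j ∧ hit b i ∧ hit b j with hmul
  set P : ι → Prop := fun i => ∃ b, multi b ∧ hit b i with hP
  set hD : s → ℝ≥0∞ := fun b => {b : X × ℝ≥0 | (D ∩ closedBall b.1 b.2).Nonempty}.indicator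
    (fun b => (f b.2 : ℝ≥0∞)) b with hhD
  have hDof : ∀ (b : s) (i : ι), i ∈ T → hit b i → hD b = f b.1.2 := fun b i hi h =>
    Set.indicator_of_mem (show b.1 ∈ {b : X × ℝ≥0 | (D ∩ closedBall b.1 b.2).Nonempty} from
      h.mono (Set.inter_subset_inter_left _ (hBD i hi))) _
  have hcost' : (C : ℝ≥0∞) * ∑' b, hD b < H := by
    have h1 : (C : ℝ≥0∞) * ∑' b, hD b < C * (C⁻¹ * H : ℝ≥0) :=
      (ENNReal.mul_lt_mul_iff_right (ENNReal.coe_ne_zero.2 hC.ne') ENNReal.coe_ne_top).2 hcost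
    rwa [← ENNReal.coe_mul, mul_inv_cancel_left₀ hC.ne'] at h1
  -- members met by a ball meeting several members
  have hbad : ∑ i ∈ T.filter P, (w i : ℝ≥0∞) < H := by
    refine lt_of_le_of_lt ?_ hcost'
    calc ∑ i ∈ T.filter P, (w i : ℝ≥0∞)
        ≤ ∑ i ∈ T.filter P, ∑' b : s, if multi b ∧ hit b i then (w i : ℝ≥0∞) else 0 := by
          refine Finset.sum_le_sum fun i hi => ?_
          obtain ⟨b, hb⟩ := (Finset.mem_filter.1 hi).2
          exact le_trans (by rw [if_pos hb]) (ENNReal.le_tsum b)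
      _ = ∑' b : s, ∑ i ∈ T.filter P, if multi b ∧ hit b i then (w i : ℝ≥0∞) else 0 :=
          (Summable.tsum_finsetSum fun _ _ => ENNReal.summable).symm
      _ ≤ ∑' b : s, C * hD b := by
          refine ENNReal.tsum_le_tsum fun b => ?_
          by_cases hb : multi b
          · simp only [hb, true_and]
            rw [← Finset.sum_filter]
            obtain ⟨i, hi, j, hj, hij, hbi, hbj⟩ := hb
            rw [hDof b i hi hbi, ← ENNReal.ofNNReal_finsetSum, ← ENNReal.coe_mul, ENNReal.coe_le_coe]
            have hmem : ∀ l ∈ T, hit b l → l ∈ (T.filter P).filter (hit b) := fun l hl h =>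
              Finset.mem_filter.2 ⟨Finset.mem_filter.2
                ⟨hl, b, ⟨i, hi, j, hj, hij, hbi, hbj⟩, h⟩, h⟩
            exact hmulti b.1 b.2 _ ((Finset.filter_subset _ _).trans (Finset.filter_subset _ _))
              (fun l hl => (Finset.mem_filter.1 hl).2)
              ⟨i, hmem i hi hbi, j, hmem j hj hbj, hij⟩
          · simp [hb]
      _ = _ := ENNReal.tsum_mul_left
  -- the other members
  have hgood : ∑ i ∈ T.filter (fun i => ¬ P i), (w i : ℝ≥0∞) < H := by
    refine lt_of_le_of_lt ?_ hcost'
    have h1 : ∀ i ∈ T.filter (fun i => ¬ P i), (w i : ℝ≥0∞) ≤ C * hitCost f s (B i) := by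
      intro i hi
      calc (w i : ℝ≥0∞) = C * (C⁻¹ * w i : ℝ≥0) := by
            rw [← ENNReal.coe_mul, mul_inv_cancel_left₀ hC.ne']
        _ ≤ _ := by gcongr; exact hcon i (Finset.mem_filter.1 hi).1
    refine (Finset.sum_le_sum h1).trans ?_
    rw [← Finset.mul_sum]
    gcongr
    simp only [hitCost]
    rw [← Summable.tsum_finsetSum fun _ _ => ENNReal.summable]
    refine ENNReal.tsum_le_tsum fun b => ?_
    -- A covering ball that meets a good member meets no other member of T, so its cost is counted
    -- once.
    by_cases hex : ∃ i ∈ T.filter (fun i => ¬ P i), hit b i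
    · obtain ⟨i, hi, hbi⟩ := hex
      rw [Finset.sum_eq_single_of_mem i hi]
      · rw [hDof b i (Finset.mem_filter.1 hi).1 hbi]
        exact Set.indicator_le_self _ _ _
      · intro j hj hji
        refine Set.indicator_of_notMem (fun hbj => (Finset.mem_filter.1 hi).2 ?_) _
        exact ⟨b, ⟨i, (Finset.mem_filter.1 hi).1, j, (Finset.mem_filter.1 hj).1, hji.symm, hbi,
          hbj⟩, hbi⟩
    · push Not at hex
      rw [Finset.sum_eq_zero]
      · exact zero_le
      · intro i hi
        exact Set.indicator_of_notMem (s := {b : X × ℝ≥0 | (B i ∩ closedBall b.1 b.2).Nonempty})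
          (hex i hi) _
  have hsum : ((2 * H : ℝ≥0) : ℝ≥0∞) < H + H := by
    calc ((2 * H : ℝ≥0) : ℝ≥0∞) ≤ ((∑ i ∈ T, w i : ℝ≥0) : ℝ≥0∞) := ENNReal.coe_le_coe.2 hW
      _ = ∑ i ∈ T.filter P, (w i : ℝ≥0∞) + ∑ i ∈ T.filter (fun i => ¬ P i), (w i : ℝ≥0∞) := by
          rw [Finset.sum_filter_add_sum_filter_not, ENNReal.ofNNReal_finsetSum]
      _ < _ := ENNReal.add_lt_add hbad hgood
  rw [← ENNReal.coe_add, ENNReal.coe_lt_coe, two_mul] at hsum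
  exact lt_irrefl _ hsum

/-- The nested-ball step: a cover which is cheap on a ball is cheap on a much smaller ball of the
system inside it. -/
lemma exists_next_ball {ι : Type*} [Countable ι] {x : ι → Fin k → ℝ} {r : ι → ℝ≥0} {lev : ι → ℕ}
    (hk : k ≠ 0) (hmono : Monotone f)
    (hanti : ∀ a b : ℝ≥0, 0 < a → a ≤ b → f b * a ^ k ≤ f a * b ^ k)
    {R : ι → ℝ} (hRf : ∀ i, R i ^ k = f (r i)) (hRpos : ∀ i, 0 < R i)
    (hR0 : ∀ ε : ℝ, 0 < ε → ∃ n, ∀ i, n ≤ lev i → R i < ε)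
    (hrR : ∀ K : ℝ, ∃ n, ∀ i, n ≤ lev i → K * (r i : ℝ) ^ k ≤ R i ^ k)
    {x₀ : Fin k → ℝ} {r₀ : ℝ≥0} (hr₀ : 0 < r₀)
    (hae : ∀ᵐ y ∂(volume.restrict (closedBall x₀ r₀)), ∀ n, ∃ i, n ≤ lev i ∧
      y ∈ closedBall (x i) (R i))
    {s : Set ((Fin k → ℝ) × ℝ≥0)} (hs : ∀ b ∈ s, 0 < b.2) {H : ℝ≥0} (hH : r₀ ^ k ≤ H)
    (hcost : hitCost f s (closedBall x₀ r₀) < ((hitConst k).toNNReal⁻¹ * H : ℝ≥0))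
    (hsH : ∀ b ∈ s, (closedBall x₀ r₀ ∩ closedBall b.1 b.2).Nonempty →
      H * b.2 ^ k ≤ f b.2 * r₀ ^ k) (n₀ : ℕ) :
    ∃ i, n₀ ≤ lev i ∧ closedBall (x i) (r i) ⊆ closedBall x₀ r₀ ∧ r i ^ k ≤ f (r i) ∧
      hitCost f s (closedBall (x i) (r i)) < ((hitConst k).toNNReal⁻¹ * f (r i) : ℝ≥0) := by
  have hr₀R : (0 : ℝ) < r₀ := hr₀
  have hp : (0 : ℝ) < (r₀ : ℝ) ^ k := by positivity
  have hHR : (r₀ : ℝ) ^ k ≤ H := by exact_mod_cast hH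
  have hH0 : (0 : ℝ) < H := hp.trans_le hHR
  have hC : (0 : ℝ) < hitConst k := one_pos.trans_le (one_le_hitConst k)
  -- Enough layers, each of content at least r₀ᵏ/(4·10ᵏ), to reach total content 2H.
  set L := ⌈8 * 10 ^ k * H / (r₀ : ℝ) ^ k⌉₊ with hLdef
  have hL0 : 0 < L := Nat.ceil_pos.2 (by positivity)
  have hL1 : 8 * 10 ^ k * H ≤ L * (r₀ : ℝ) ^ k := by
    rw [← div_le_iff₀ hp]; exact Nat.le_ceil _
  have hL2 : L * (r₀ : ℝ) ^ k ≤ (8 * 10 ^ k + 1) * H := by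
    have h1 := (Nat.ceil_lt_add_one (show 0 ≤ 8 * 10 ^ k * H / (r₀ : ℝ) ^ k by positivity)).le
    rw [← hLdef] at h1
    calc L * (r₀ : ℝ) ^ k ≤ (8 * 10 ^ k * H / (r₀ : ℝ) ^ k + 1) * (r₀ : ℝ) ^ k := by gcongr
      _ = 8 * 10 ^ k * H + (r₀ : ℝ) ^ k := by field_simp
      _ ≤ _ := by linarith
  obtain ⟨n₁, hn₁⟩ := hrR 1
  obtain ⟨T, layer, hT, hlay, hlev, hsub, -, -, hlow⟩ := exists_isLayered hRpos hR0 hrR hk hr₀R hae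
    hL0 (max n₀ n₁) le_rfl
  have hrleR : ∀ i ∈ T, (r i : ℝ) ≤ R i := fun i hi => by
    have := hT.two_mul_le i hi
    have h0 : (0 : ℝ) ≤ r i := (r i).2
    linarith
  have hBD : ∀ i ∈ T, closedBall (x i) (r i) ⊆ closedBall x₀ r₀ := fun i hi =>
    (closedBall_subset_closedBall (hrleR i hi)).trans (hsub i hi)
  refine (exists_hitCost_lt (f := f) (s := s) (D := closedBall x₀ r₀)
    (B := fun i => closedBall (x i) (r i)) (w := fun i => f (r i)) (T := T)
    (C := (hitConst k).toNNReal) (H := H) (Real.toNNReal_pos.2 hC) hBD hcost ?_ ?_).elim ?_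
  rotate_left 2
  · rintro i ⟨hi, hlt⟩
    refine ⟨i, (le_max_left _ _).trans (hlev i hi), hBD i hi, ?_, hlt⟩
    have := hn₁ i ((le_max_right _ _).trans (hlev i hi))
    rw [one_mul, hRf] at this
    exact_mod_cast this
  · rintro ⟨z, a⟩ hb K hKT hKhit ⟨i, hi, j, hj, hij⟩
    have ha : 0 < a := hs _ hb
    have haR : (0 : ℝ) < a := ha
    -- If r ≤ 2a then f(r) ≤ f(2a) ≤ 2ᵏ f(a), by monotonicity of f and of the ratio.
    have h1 := hT.sum_hit_le (a := a) (b := 2 ^ k * f a) hlay ha.le (fun l _ hl => by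
      rw [hRf]
      have h2 : r l ≤ 2 * a := by exact_mod_cast hl
      have h3 := (mul_le_mul_left (hmono h2) (a ^ k)).trans
        (hanti a (2 * a) ha (by rw [two_mul]; exact le_self_add))
      have h4 : (f (r l) : ℝ) * (a : ℝ) ^ k ≤ f a * (2 * a) ^ k := by exact_mod_cast h3
      rw [mul_pow] at h4
      refine le_of_mul_le_mul_right (h4.trans (le_of_eq ?_)) (pow_pos haR k)
      ring) hKT hKhit hi hj hij
    have h5 : (H : ℝ) * (a : ℝ) ^ k ≤ f a * (r₀ : ℝ) ^ k := by
      exact_mod_cast hsH _ hb ((hKhit i hi).mono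
        (Set.inter_subset_inter_left _ (hBD i (hKT hi))))
    have h6 : L * (a : ℝ) ^ k ≤ (8 * 10 ^ k + 1) * f a := by
      refine le_of_mul_le_mul_right ?_ hp
      calc L * (a : ℝ) ^ k * (r₀ : ℝ) ^ k = (L * (r₀ : ℝ) ^ k) * (a : ℝ) ^ k := by ring
        _ ≤ ((8 * 10 ^ k + 1) * H) * (a : ℝ) ^ k := by gcongr
        _ = (8 * 10 ^ k + 1) * (H * (a : ℝ) ^ k) := by ring
        _ ≤ (8 * 10 ^ k + 1) * (f a * (r₀ : ℝ) ^ k) := by gcongr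
        _ = _ := by ring
    rw [← NNReal.coe_le_coe]
    push_cast
    rw [Real.coe_toNNReal _ hC.le]
    simp only [hRf] at h1
    refine h1.trans ?_
    rw [mul_pow, hitConst]
    have : (0 : ℝ) < 7 ^ k := by positivity
    nlinarith
  · rw [← NNReal.coe_le_coe]
    push_cast
    simp only [hRf] at hlow
    refine le_trans ?_ hlow
    rw [mul_div_assoc', le_div_iff₀ (by positivity)]
    linarith

/-- The mass transference principle for a dimension function `f` with `f(r) / rᵏ` increasing to
infinity as `r → 0`: if almost every point of a ball lies in arbitrarily late balls of radii
`f(r)^(1/k)`, then the set of points lying in arbitrarily late balls of radii `r` has infinite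
Hausdorff `f`-measure. -/
theorem hausdorffFMeasure_eq_top_of_ae {ι : Type*} [Countable ι] {x : ι → Fin k → ℝ} {r : ι → ℝ≥0}
    {lev : ι → ℕ} (hk : k ≠ 0) (hf : IsDimensionFunction f)
    (hanti : ∀ a b : ℝ≥0, 0 < a → a ≤ b → f b * a ^ k ≤ f a * b ^ k)
    (hunb : ∀ K : ℝ≥0, ∃ δ > 0, ∀ a, 0 < a → a ≤ δ → K * a ^ k ≤ f a)
    (hrpos : ∀ i, 0 < r i) (hr0 : ∀ ε : ℝ≥0, 0 < ε → ∃ n, ∀ i, n ≤ lev i → r i < ε)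
    {x₀ : Fin k → ℝ} {r₀ : ℝ≥0} (hr₀ : 0 < r₀)
    (hae : ∀ᵐ y ∂(volume.restrict (closedBall x₀ r₀)), ∀ n, ∃ i, n ≤ lev i ∧
      y ∈ closedBall (x i) ((f (r i) : ℝ) ^ (k : ℝ)⁻¹))
    {E : Set (Fin k → ℝ)}
    (hE : ∀ y ∈ closedBall x₀ r₀, (∀ n, ∃ i, n ≤ lev i ∧ y ∈ closedBall (x i) (r i)) → y ∈ E) :
    hausdorffFMeasure f E = ∞ := by
  have hfpos : ∀ a, 0 < a → 0 < f a := by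
    intro a ha
    obtain ⟨δ, hδ, h⟩ := hunb 1
    have h1 := h (min a δ) (lt_min ha hδ) (min_le_right _ _)
    rw [one_mul] at h1
    exact (pow_pos (lt_min ha hδ) k).trans_le (h1.trans (hf.monotone (min_le_left _ _)))
  have hfsmall : ∀ ε : ℝ≥0, 0 < ε → ∃ n, ∀ i, n ≤ lev i → f (r i) < ε := by
    intro ε hε
    have h1 := hf.tendsto_zero.eventually_lt_const hε
    rw [eventually_nhdsWithin_iff, Metric.eventually_nhds_iff] at h1
    obtain ⟨δ, hδ, h1⟩ := h1
    obtain ⟨n, hn⟩ := hr0 ⟨δ, hδ.le⟩ hδ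
    refine ⟨n, fun i hi => h1 ?_ (hrpos i)⟩
    rw [NNReal.dist_eq]
    have : (r i : ℝ) < δ := hn i hi
    simpa using this
  set R : ι → ℝ := fun i => (f (r i) : ℝ) ^ (k : ℝ)⁻¹ with hR
  have hRf : ∀ i, R i ^ k = f (r i) := fun i => Real.rpow_inv_natCast_pow (f (r i)).2 hk
  have hRpos : ∀ i, 0 < R i := fun i => Real.rpow_pos_of_pos (hfpos _ (hrpos i)) _
  have hR0 : ∀ ε : ℝ, 0 < ε → ∃ n, ∀ i, n ≤ lev i → R i < ε := by
    intro ε hε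
    obtain ⟨n, hn⟩ := hfsmall ⟨ε ^ k, by positivity⟩ (pow_pos hε k)
    refine ⟨n, fun i hi => lt_of_pow_lt_pow_left₀ k hε.le ?_⟩
    rw [hRf]
    exact hn i hi
  have hrR : ∀ K : ℝ, ∃ n, ∀ i, n ≤ lev i → K * (r i : ℝ) ^ k ≤ R i ^ k := by
    intro K
    obtain ⟨δ, hδ, h⟩ := hunb K.toNNReal
    obtain ⟨n, hn⟩ := hr0 δ hδ
    refine ⟨n, fun i hi => ?_⟩
    have h1 : (K.toNNReal : ℝ) * (r i : ℝ) ^ k ≤ f (r i) := by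
      exact_mod_cast h (r i) (hrpos i) (hn i hi).le
    rw [hRf]
    refine le_trans ?_ h1
    gcongr
    exact Real.le_coe_toNNReal K
  set C := (hitConst k).toNNReal with hC
  have hC1 : 1 ≤ C := by
    rw [hC, Real.one_le_toNNReal]; exact one_le_hitConst k
  have hC0 : 0 < C := one_pos.trans_le hC1
  refine ENNReal.eq_top_of_forall_nnreal_le fun M => ?_
  -- Below ρ the ratio f(a)/aᵏ exceeds H/r₀ᵏ, which starts the nested construction. H also dominates
  -- C (M + 1), so a cover of cost below M is cheap on the initial ball.
  obtain ⟨ρ, hρ, hρf⟩ := hunb (max (C * (M + 1)) (r₀ ^ k) / r₀ ^ k)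
  set H := max (C * (M + 1)) (r₀ ^ k) with hH
  refine le_trans ?_ (le_iSup₂ (f := fun (ρ : ℝ≥0) (_ : 0 < ρ) => hausdorffPre f ρ E) ρ hρ)
  refine le_iInf₂ fun s hs => ?_
  by_contra! hlt
  set P : ι → Prop := fun i => closedBall (x i) (r i) ⊆ closedBall x₀ r₀ ∧ r i ^ k ≤ f (r i) ∧
      hitCost f s (closedBall (x i) (r i)) < (C⁻¹ * f (r i) : ℝ≥0) with hP
  have hstart : ∃ i, P i := by
    refine (exists_next_ball hk hf.monotone hanti hRf hRpos hR0 hrR hr₀ hae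
      hs.radius_pos (H := H) (le_max_right _ _) ?_ ?_ 0).elim ?_
    rotate_left 2
    · rintro i ⟨-, h1, h2, h3⟩
      exact ⟨i, h1, h2, h3⟩
    · refine (hitCost_le_tsum f s _).trans_lt (hlt.trans ?_)
      rw [ENNReal.coe_lt_coe]
      calc M < M + 1 := lt_add_one M
        _ = C⁻¹ * (C * (M + 1)) := (inv_mul_cancel_left₀ hC0.ne' _).symm
        _ ≤ _ := by gcongr; exact le_max_left _ _
    · intro b hb _
      have h1 := hρf b.2 (hs.radius_pos b hb) (hs.radius_le b hb)
      rwa [div_mul_eq_mul_div, div_le_iff₀ (pow_pos hr₀ k)] at h1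
  have hnext : ∀ (n : ℕ) (i : {i // P i}), ∃ j : {i // P i}, n ≤ lev j ∧
      closedBall (x j) (r j) ⊆ closedBall (x i) (r i) := by
    rintro n ⟨i, hi1, hi2, hi3⟩
    refine (exists_next_ball hk hf.monotone hanti hRf hRpos hR0 hrR (hrpos i)
      (ae_restrict_of_ae_restrict_of_subset hi1 hae) hs.radius_pos (H := f (r i)) hi2 hi3 ?_ n).elim
      ?_
    rotate_left
    · rintro j ⟨hj, h1, h2, h3⟩
      exact ⟨⟨j, h1.trans hi1, h2, h3⟩, hj, h1⟩
    · intro b hb hhit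
      -- A covering ball meeting the current ball costs less than f(r i), so its radius is at most r
      -- i; monotonicity of the ratio then supplies the hypothesis for the next step.
      refine hanti b.2 (r i) (hs.radius_pos b hb) ?_
      by_contra! hlt'
      have h4 := (le_hitCost f hb hhit).trans_lt hi3
      rw [ENNReal.coe_lt_coe] at h4
      have h5 : C⁻¹ * f (r i) ≤ f (r i) := mul_le_of_le_one_left zero_le (inv_le_one_of_one_le₀ hC1)
      exact absurd (h4.trans_le h5) (hf.monotone hlt'.le).not_gt
  choose next hnext1 hnext2 using hnext
  set seq : ℕ → {i // P i} := fun n => Nat.rec ⟨hstart.choose, hstart.choose_spec⟩ next n with hseq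
  have hsucc : ∀ n, seq (n + 1) = next n (seq n) := fun n => rfl
  obtain ⟨y, hy⟩ := IsCompact.nonempty_iInter_of_sequence_nonempty_isCompact_isClosed
    (fun n => closedBall (x (seq n)) (r (seq n)))
    (fun n => by rw [hsucc]; exact hnext2 n (seq n))
    (fun n => nonempty_closedBall.2 (r _).2) (isCompact_closedBall _ _)
    (fun n => isClosed_closedBall)
  rw [Set.mem_iInter] at hy
  have hyE : y ∈ E := by
    refine hE y ((seq 0).2.1 (hy 0)) fun n => ⟨seq (n + 1), ?_, hy (n + 1)⟩
    rw [hsucc]; exact hnext1 n (seq n)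
  -- The covering ball containing y meets every nested ball, so f(b.2) stays below f of radii for
  -- which f tends to 0.
  obtain ⟨b, hb, hyb⟩ := Set.mem_iUnion₂.1 (hs.subset hyE)
  obtain ⟨n, hn⟩ := hfsmall (f b.2) (hfpos _ (hs.radius_pos b hb))
  have h1 := hn (seq (n + 1)) (by rw [hsucc]; exact hnext1 n (seq n))
  have h2 := (le_hitCost f hb ⟨y, hy (n + 1), hyb⟩).trans_lt (seq (n + 1)).2.2.2
  rw [ENNReal.coe_lt_coe] at h2
  exact absurd (h2.trans_le (mul_le_of_le_one_left zero_le (inv_le_one_of_one_le₀ hC1)))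
    h1.not_gt

end Transference

/-! ### Monotonicity and subadditivity of the premeasure -/

section HausdorffMeasure

variable {X : Type*} [MetricSpace X] {f : ℝ≥0 → ℝ≥0}

lemma IsBallCover.mono {ρ : ℝ≥0} {E F : Set X} {s : Set (X × ℝ≥0)} (hs : IsBallCover ρ F s)
    (h : E ⊆ F) : IsBallCover ρ E s :=
  ⟨hs.countable, hs.radius_pos, hs.radius_le, h.trans hs.subset⟩

lemma hausdorffPre_mono (f : ℝ≥0 → ℝ≥0) (ρ : ℝ≥0) {E F : Set X} (h : E ⊆ F) :
    hausdorffPre f ρ E ≤ hausdorffPre f ρ F :=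
  le_iInf₂ fun s hs => iInf₂_le s (hs.mono h)

lemma hausdorffFMeasure_mono (f : ℝ≥0 → ℝ≥0) {E F : Set X} (h : E ⊆ F) :
    hausdorffFMeasure f E ≤ hausdorffFMeasure f F :=
  iSup₂_mono fun ρ _ => hausdorffPre_mono f ρ h

lemma IsBallCover.union {ρ : ℝ≥0} {E F : Set X} {s t : Set (X × ℝ≥0)} (hs : IsBallCover ρ E s)
    (ht : IsBallCover ρ F t) : IsBallCover ρ (E ∪ F) (s ∪ t) where
  countable := hs.countable.union ht.countable
  radius_pos b hb := hb.elim (hs.radius_pos b) (ht.radius_pos b)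
  radius_le b hb := hb.elim (hs.radius_le b) (ht.radius_le b)
  subset := by
    rw [Set.biUnion_union]
    exact Set.union_subset_union hs.subset ht.subset

lemma hausdorffPre_union_le (f : ℝ≥0 → ℝ≥0) (ρ : ℝ≥0) (E F : Set X) :
    hausdorffPre f ρ (E ∪ F) ≤ hausdorffPre f ρ E + hausdorffPre f ρ F := by
  simp only [hausdorffPre, ENNReal.iInf_add, ENNReal.add_iInf]
  refine le_iInf₂ fun t ht => le_iInf₂ fun s hs => ?_
  refine le_trans (iInf₂_le (s ∪ t) (hs.union ht)) ?_
  exact (ENNReal.tsum_union_le (fun b : X × ℝ≥0 => (f b.2 : ℝ≥0∞)) s t)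

end HausdorffMeasure

/-! ### Passing between the supremum and ℓᵖ metrics -/

section PiLp

variable {p : ℝ≥0∞} [Fact (1 ≤ p)] {k : ℕ} {f : ℝ≥0 → ℝ≥0}

/-- Hausdorff measures for the supremum metric are the smallest. -/
lemma hausdorffFMeasure_le_preimage_ofLp (E : Set (Fin k → ℝ)) :
    hausdorffFMeasure f E ≤
      hausdorffFMeasure f ((WithLp.ofLp : PiLp p (fun _ : Fin k => ℝ) → (Fin k → ℝ)) ⁻¹' E) := by
  refine iSup₂_mono fun ρ _ => le_iInf₂ fun s hs => ?_
  set g : PiLp p (fun _ : Fin k => ℝ) × ℝ≥0 → (Fin k → ℝ) × ℝ≥0 :=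
    fun b => (WithLp.ofLp b.1, b.2) with hg
  have hginj : Function.Injective g := fun a b h => by
    simp only [hg, Prod.mk.injEq] at h
    exact Prod.ext (WithLp.ofLp_injective p h.1) h.2
  have hcov : IsBallCover ρ E (g '' s) := by
    refine ⟨hs.countable.image g, ?_, ?_, fun y hy => ?_⟩
    · rintro _ ⟨b, hb, rfl⟩; exact hs.radius_pos b hb
    · rintro _ ⟨b, hb, rfl⟩; exact hs.radius_le b hb
    · obtain ⟨b, hb, hyb⟩ := Set.mem_iUnion₂.1 (hs.subset
        (show WithLp.toLp p y ∈ WithLp.ofLp ⁻¹' E from hy))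
      refine Set.mem_biUnion (Set.mem_image_of_mem g hb) ?_
      rw [mem_closedBall] at hyb ⊢
      have h1 := (PiLp.lipschitzWith_ofLp p (fun _ : Fin k => ℝ)).dist_le_mul (WithLp.toLp p y) b.1
      rw [NNReal.coe_one, one_mul] at h1
      exact h1.trans hyb
  refine (iInf₂_le _ hcov).trans (le_of_eq ?_)
  exact tsum_image (fun b : (Fin k → ℝ) × ℝ≥0 => (f b.2 : ℝ≥0∞)) hginj.injOn

/-- Lebesgue null sets have zero Hausdorff `f`-measure if `f(r) = O(rᵏ)`. -/
lemma hausdorffPre_preimage_ofLp_eq_zero (hk : k ≠ 0) {C : ℝ≥0}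
    (hfC : ∀ a, 0 < a → a ≤ 1 → f a ≤ C * a ^ k) {E : Set (Fin k → ℝ)} (hE : volume E = 0)
    {ρ : ℝ≥0} (hρ : 0 < ρ) :
    hausdorffPre f ρ ((WithLp.ofLp : PiLp p (fun _ : Fin k => ℝ) → (Fin k → ℝ)) ⁻¹' E) = 0 := by
  -- The ℓᵖ distance is at most K = k^(1/p) times the supremum distance, so enlarging radii by K
  -- turns a cover by cubes into a cover by ℓᵖ balls.
  set K : ℝ≥0 := (Fintype.card (Fin k) : ℝ≥0) ^ (1 / p).toReal with hK
  have hK0 : 0 < K := NNReal.rpow_pos (by simpa using Nat.pos_of_ne_zero hk)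
  have hanti := PiLp.antilipschitzWith_ofLp p (fun _ : Fin k => ℝ)
  refine le_antisymm (ENNReal.le_of_forall_pos_le_add fun ε hε _ => ?_) zero_le
  rw [zero_add]
  set δ : ℝ≥0 := min ρ 1 / K with hδ
  have hδ0 : 0 < δ := div_pos (lt_min hρ one_pos) hK0
  set η : ℝ≥0 := ε / (C * K ^ k + 1) with hη
  have hη0 : 0 < η := by positivity
  obtain ⟨t, r, htc, -, hr, hcov, hsum⟩ := Besicovitch.exists_closedBall_covering_tsum_measure_le
    volume (ε := (η : ℝ≥0∞)) (ENNReal.coe_ne_zero.2 hη0.ne') (fun _ => Set.Ioo 0 (δ : ℝ)) E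
    (fun y _ a ha => ⟨min (δ : ℝ) a / 2, by
      have h1 : 0 < min (δ : ℝ) a := lt_min hδ0 ha
      have h2 := min_le_left (δ : ℝ) a
      have h3 := min_le_right (δ : ℝ) a
      exact ⟨⟨by linarith, by linarith⟩, ⟨by linarith, by linarith⟩⟩⟩)
  rw [hE, zero_add] at hsum
  set g : t → PiLp p (fun _ : Fin k => ℝ) × ℝ≥0 :=
    fun y => (WithLp.toLp p y.1, K * (r y.1).toNNReal) with hg
  have hginj : Function.Injective g := fun a b h => by
    simp only [hg, Prod.mk.injEq] at h
    exact Subtype.ext (WithLp.toLp_injective p h.1)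
  have hrpos : ∀ y : t, 0 < (r y).toNNReal := fun y => Real.toNNReal_pos.2 (hr y y.2).1
  have hrle : ∀ y : t, K * (r y).toNNReal ≤ min ρ 1 := fun y => by
    have h1 : (r y).toNNReal ≤ δ := Real.toNNReal_le_iff_le_coe.2 (hr y y.2).2.le
    rw [hδ, le_div_iff₀ hK0] at h1
    rwa [mul_comm]
  have : Countable t := htc
  have hc : IsBallCover ρ ((WithLp.ofLp : PiLp p (fun _ : Fin k => ℝ) → (Fin k → ℝ)) ⁻¹' E)
      (Set.range g) := by
    refine ⟨Set.countable_range g, ?_, ?_, fun y hy => ?_⟩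
    · rintro _ ⟨y, rfl⟩; exact mul_pos hK0 (hrpos y)
    · rintro _ ⟨y, rfl⟩; exact (hrle y).trans (min_le_left _ _)
    · obtain ⟨c, hc, hyc⟩ := Set.mem_iUnion₂.1 (hcov hy)
      refine Set.mem_biUnion (Set.mem_range_self (⟨c, hc⟩ : t)) ?_
      rw [mem_closedBall] at hyc ⊢
      refine (hanti.le_mul_dist y (WithLp.toLp p c)).trans ?_
      simp only [hg, NNReal.coe_mul]
      rw [Real.coe_toNNReal _ (hr c hc).1.le]
      gcongr
  refine (iInf₂_le _ hc).trans ?_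
  rw [tsum_range (fun b : PiLp p (fun _ : Fin k => ℝ) × ℝ≥0 => (f b.2 : ℝ≥0∞)) hginj]
  calc ∑' y : t, (f (g y).2 : ℝ≥0∞)
      ≤ ∑' y : t, (C * K ^ k : ℝ≥0) * volume (closedBall (y : Fin k → ℝ) (r y)) := by
        refine ENNReal.tsum_le_tsum fun y => ?_
        have h1 := hfC _ (mul_pos hK0 (hrpos y)) ((hrle y).trans (min_le_right _ _))
        rw [Real.volume_pi_closedBall _ (hr y y.2).1.le, ENNReal.ofReal, ← ENNReal.coe_mul,
          ENNReal.coe_le_coe, Fintype.card_fin, Real.toNNReal_pow (by linarith [(hr y y.2).1])]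
        refine h1.trans ?_
        rw [mul_pow, ← mul_assoc]
        gcongr
        linarith [(hr y y.2).1]
    _ = (C * K ^ k : ℝ≥0) * ∑' y : t, volume (closedBall (y : Fin k → ℝ) (r y)) :=
        ENNReal.tsum_mul_left
    _ ≤ (C * K ^ k : ℝ≥0) * η := by gcongr
    _ ≤ ε := by
        rw [← ENNReal.coe_mul, ENNReal.coe_le_coe, hη, mul_div_assoc', div_le_iff₀ (by positivity),
          mul_comm]
        gcongr
        exact le_self_add

/-- If `f(r) = O(rᵏ)`, a subset of full Lebesgue measure has full Hausdorff `f`-measure. -/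
lemma hausdorffFMeasure_preimage_ofLp_eq (hk : k ≠ 0) {C : ℝ≥0}
    (hfC : ∀ a, 0 < a → a ≤ 1 → f a ≤ C * a ^ k) {E F : Set (Fin k → ℝ)} (hEF : E ⊆ F)
    (hnull : volume (F \ E) = 0) :
    hausdorffFMeasure f ((WithLp.ofLp : PiLp p (fun _ : Fin k => ℝ) → (Fin k → ℝ)) ⁻¹' E) =
      hausdorffFMeasure f ((WithLp.ofLp : PiLp p (fun _ : Fin k => ℝ) → (Fin k → ℝ)) ⁻¹' F) := by
  refine le_antisymm (hausdorffFMeasure_mono f (Set.preimage_mono hEF)) ?_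
  refine iSup₂_mono fun ρ hρ => ?_
  rw [← Set.union_sdiff_cancel hEF, Set.preimage_union]
  refine (hausdorffPre_union_le _ _ _ _).trans ?_
  rw [hausdorffPre_preimage_ofLp_eq_zero hk hfC hnull hρ, add_zero]

end PiLp

/-! ### The approximation set in the two regimes -/

section Approximation

variable {k : ℕ} {f : ℝ≥0 → ℝ≥0} {ψ : ℕ → ℝ≥0}

/-- Discarding the countably many rational points forces t q > 0: a ball of radius 0 contains only
its rational centre. -/
lemma ae_exists_primitive {t : ℕ → ℝ} (hk : 2 ≤ k) (ht0 : ∀ q, 0 ≤ t q)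
    (hdiv : ¬ Summable fun q => t q ^ k) :
    ∀ᵐ y ∂(volume.restrict (unitCube k)), ∀ n : ℕ, ∃ (q : ℕ) (p : Fin k → ℤ), n < q ∧
      Int.gcd (Finset.univ.gcd p) (q : ℤ) = 1 ∧ 0 < t q ∧
      y ∈ closedBall (ratPoint q p) (t q / q) := by
  have : Nonempty (Fin k) := ⟨⟨0, by omega⟩⟩
  have hrat : volume (Set.range fun z : ℕ × (Fin k → ℤ) => ratPoint z.1 z.2) = 0 :=
    (Set.countable_range _).measure_zero _
  have hrat' : ∀ᵐ y ∂(volume.restrict (unitCube k)),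
      y ∉ Set.range fun z : ℕ × (Fin k → ℤ) => ratPoint z.1 z.2 :=
    ae_restrict_of_ae (measure_eq_zero_iff_ae_notMem.1 hrat)
  filter_upwards [ae_exists_mem_nearPrimitive hk ht0 hdiv, hrat'] with y hy hyr n
  obtain ⟨q, hq, hyq⟩ := hy n
  obtain ⟨p, hp, hyp⟩ := Set.mem_iUnion₂.1 hyq
  refine ⟨q, p, hq, (mem_primitivePoints.1 hp).2, (ht0 q).lt_of_ne fun h => hyr ⟨(q, p), ?_⟩, hyp⟩
  rw [← h, zero_div, closedBall_zero, Set.mem_singleton_iff] at hyp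
  exact hyp.symm

/-- Unbounded denominators already give infinitely many pairs. The strict bound on r turns closed
balls into the strict inequalities required. -/
lemma mem_approxSetStar_of_forall_exists {y : Fin k → ℝ} (hy : y ∈ unitCube k)
    (h : ∀ n : ℕ, ∃ (q : ℕ) (p : Fin k → ℤ) (r : ℝ), n < q ∧
      Int.gcd (Finset.univ.gcd p) (q : ℤ) = 1 ∧ r < ψ q / q ∧ y ∈ closedBall (ratPoint q p) r) :
    y ∈ approxSetStar k ψ := by
  refine ⟨hy, Set.Infinite.of_image Prod.snd (Set.infinite_of_forall_exists_gt fun n => ?_)⟩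
  obtain ⟨q, p, r, hq, hp, hr, hyp⟩ := h n
  refine ⟨q, ⟨(p, q), ⟨(Nat.zero_le n).trans_lt hq, hp, fun i => ?_⟩, rfl⟩, hq⟩
  exact ((dist_le_pi_dist y (ratPoint q p) i).trans hyp).trans_lt hr

lemma not_summable_of_tsum_pnat_eq_top {g : ℕ → ℝ≥0}
    (h : ∑' n : ℕ+, (g n : ℝ≥0∞) = ∞) : ¬ Summable fun n => (g n : ℝ) := by
  intro hs
  have h0 : Summable g := NNReal.summable_coe.1 hs
  have h1 : Summable fun n : ℕ+ => g n := 
    NNReal.summable_comp_injective h0 PNat.coe_injective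
  exact (ENNReal.tsum_coe_ne_top_iff_summable (f := fun n : ℕ+ => g n)).2 h1 h

lemma IsDimensionFunction.map_zero (hf : IsDimensionFunction f) : f 0 = 0 :=
  tendsto_nhds_unique (hf.continuous.continuousWithinAt (s := Set.Ioi 0)).tendsto hf.tendsto_zero

/-- The case `f(r) = O(rᵏ)`. -/
lemma volume_unitCube_diff_approxSetStar (hk : 2 ≤ k) (hf0 : f 0 = 0) {C : ℝ≥0}
    (hfC : ∀ a, 0 < a → a ≤ 1 → f a ≤ C * a ^ k)
    (hdiv : ¬ Summable fun n : ℕ => ((f (ψ n / n) * n ^ k : ℝ≥0) : ℝ)) :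
    volume (unitCube k \ approxSetStar k ψ) = 0 := by
  -- Halving ψ leaves room for the strict inequality. If ∑ ψ(n)ᵏ converged, then ψ ≤ 1 eventually,
  -- and f(ψ(n)/n) nᵏ ≤ C ψ(n)ᵏ would make the original series converge.
  have hψ : ¬ Summable fun n => ((ψ n : ℝ) / 2) ^ k := by
    intro h
    have h1 : Summable fun n => (ψ n : ℝ) ^ k := by
      refine (h.mul_left (2 ^ k)).congr fun n => ?_
      rw [← mul_pow]; congr 1; ring
    refine hdiv (Summable.of_norm_bounded_eventually_nat (h1.mul_left (C : ℝ)) ?_)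
    have h2 := h1.tendsto_atTop_zero.eventually_lt_const one_pos
    filter_upwards [h2, Filter.eventually_ge_atTop 1] with n hn hn1
    have hn0 : (0 : ℝ≥0) < n := by exact_mod_cast hn1
    rw [Real.norm_of_nonneg NNReal.zero_le_coe]
    have h3 : ψ n ≤ 1 := by
      by_contra! hlt
      exact absurd hn (one_le_pow₀ (by exact_mod_cast hlt.le)).not_gt
    have h4 : ψ n / n ≤ 1 := by
      rw [div_le_one hn0]; exact h3.trans (by exact_mod_cast hn1)
    have h5 : f (ψ n / n) ≤ C * (ψ n / n) ^ k := by
      rcases (zero_le (a := ψ n / n)).eq_or_lt with h0 | h0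
      · rw [← h0, hf0]; exact zero_le
      · exact hfC _ h0 h4
    have h6 : f (ψ n / n) * n ^ k ≤ C * ψ n ^ k := by
      calc _ ≤ C * (ψ n / n) ^ k * n ^ k := by gcongr
        _ = C * ψ n ^ k := by rw [mul_assoc, ← mul_pow, div_mul_cancel₀ _ hn0.ne']
    exact_mod_cast h6
  have hcube : MeasurableSet (unitCube k) := by
    rw [unitCube_eq_Icc]; exact measurableSet_Icc
  have hae := (ae_restrict_iff' hcube).1 (ae_exists_primitive hk (fun n => by positivity) hψ)
  rw [measure_eq_zero_iff_ae_notMem]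
  filter_upwards [hae] with y hcon hy
  refine hy.2 ?_
  refine mem_approxSetStar_of_forall_exists hy.1 fun n => ?_
  obtain ⟨q, p, hq, hp, hpos, hyp⟩ := hcon hy.1 n
  refine ⟨q, p, _, hq, hp, ?_, hyp⟩
  have hq0 : (0 : ℝ) < q := by exact_mod_cast (Nat.zero_le n).trans_lt hq
  gcongr
  linarith

/-- Halving and truncating `ψ` does not affect the divergence of the series. -/
lemma not_summable_min_half (hf1 : 0 < f 1)
    (hanti : ∀ a b : ℝ≥0, 0 < a → a ≤ b → f b * a ^ k ≤ f a * b ^ k)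
    (hdiv : ¬ Summable fun n : ℕ => ((f (ψ n / n) * n ^ k : ℝ≥0) : ℝ)) :
    ¬ Summable fun n : ℕ => ((f (min (ψ n / 2) 1 / n) * n ^ k : ℝ≥0) : ℝ) := by
  intro h
  refine hdiv (Summable.of_norm_bounded_eventually_nat (h.mul_left (2 ^ k)) ?_)
  have h1 := h.tendsto_atTop_zero.eventually_lt_const (show (0 : ℝ) < f 1 from hf1)
  filter_upwards [h1, Filter.eventually_ge_atTop 1] with n hn hn1
  have hn0 : (0 : ℝ≥0) < n := by exact_mod_cast hn1
  rw [Real.norm_of_nonneg NNReal.zero_le_coe]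
  rw [NNReal.coe_lt_coe] at hn
  -- Where the truncation is active the term is f(1/n) nᵏ ≥ f(1) > 0, impossible far out in a
  -- convergent series.
  have h2 : ψ n / 2 ≤ 1 := by
    by_contra! hlt
    rw [min_eq_right hlt.le] at hn
    have h3 := hanti (1 / n) 1 (by positivity) (by
      rw [div_le_one hn0]; exact_mod_cast hn1)
    rw [one_pow, mul_one, div_pow, one_pow, mul_one_div, div_le_iff₀ (by positivity)] at h3
    exact absurd hn h3.not_gt
  rw [min_eq_left h2]
  have h3 : f (ψ n / n) ≤ 2 ^ k * f (ψ n / 2 / n) := by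
    rcases (zero_le (a := ψ n)).eq_or_lt with h0 | h0
    · rw [← h0, zero_div, zero_div, zero_div]
      exact le_mul_of_one_le_left zero_le (one_le_pow₀ one_le_two)
    · have h4 := hanti (ψ n / 2 / n) (ψ n / n) (by positivity) (by
        gcongr; exact half_le_self zero_le)
      have e : ψ n / n = 2 * (ψ n / 2 / n) := by field_simp
      rw [show (ψ n / n) ^ k = 2 ^ k * (ψ n / 2 / n) ^ k by rw [← mul_pow, ← e]] at h4
      refine le_of_mul_le_mul_right (h4.trans_eq ?_) (show 0 < (ψ n / 2 / n) ^ k by positivity)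
      ring
  have h5 : f (ψ n / n) * n ^ k ≤ 2 ^ k * (f (ψ n / 2 / n) * n ^ k) := by
    rw [← mul_assoc]; gcongr
  exact_mod_cast h5

lemma closedBall_half_eq_unitCube (k : ℕ) :
    closedBall (fun _ : Fin k => (1 / 2 : ℝ)) ((1 / 2 : ℝ≥0) : ℝ) = unitCube k := by
  ext y
  rw [mem_closedBall, dist_pi_le_iff (by positivity)]
  refine forall_congr' fun i => ?_
  rw [Real.dist_eq, abs_le]
  push_cast
  constructor <;> rintro ⟨h1, h2⟩ <;> constructor <;> linarith

/-- The case where `f(r) / rᵏ` increases to infinity as `r → 0`. -/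
lemma hausdorffFMeasure_approxSetStar_eq_top (hk : 2 ≤ k) (hf : IsDimensionFunction f)
    (hanti : ∀ a b : ℝ≥0, 0 < a → a ≤ b → f b * a ^ k ≤ f a * b ^ k)
    (hunb : ∀ K : ℝ≥0, ∃ δ > 0, ∀ a, 0 < a → a ≤ δ → K * a ^ k ≤ f a)
    (hdiv : ¬ Summable fun n : ℕ => ((f (ψ n / n) * n ^ k : ℝ≥0) : ℝ)) :
    hausdorffFMeasure f (approxSetStar k ψ) = ∞ := by
  have hk0 : k ≠ 0 := by omega
  have hf1 : 0 < f 1 := by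
    obtain ⟨δ, hδ, h⟩ := hunb 1
    have h1 := h (min 1 δ) (lt_min one_pos hδ) (min_le_right _ _)
    rw [one_mul] at h1
    exact (pow_pos (lt_min one_pos hδ) k).trans_le (h1.trans (hf.monotone (min_le_left _ _)))
  set ρ : ℕ → ℝ≥0 := fun q => min (ψ q / 2) 1 / q with hρ
  -- With this t the balls of radius t(q)/q are exactly those of radius f(ρ(q))^(1/k), and t(q)ᵏ =
  -- f(ρ(q)) qᵏ is the term of the divergent series.
  have hae := ae_exists_primitive (t := fun q => q * (f (ρ q) : ℝ) ^ (k : ℝ)⁻¹) hk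
    (fun q => by positivity) fun h =>
      not_summable_min_half hf1 hanti hdiv (h.congr fun q => by
        rw [mul_pow, Real.rpow_inv_natCast_pow NNReal.zero_le_coe hk0, mul_comm, NNReal.coe_mul,
          NNReal.coe_pow, NNReal.coe_natCast])
  rw [← closedBall_half_eq_unitCube] at hae
  refine hausdorffFMeasure_eq_top_of_ae
    (ι := {i : ℕ × (Fin k → ℤ) // 0 < ρ i.1 ∧ Int.gcd (Finset.univ.gcd i.2) (i.1 : ℤ) = 1})
    (x := fun i => ratPoint i.1.1 i.1.2) (r := fun i => ρ i.1.1) (lev := fun i => i.1.1)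
    hk0 hf hanti hunb (fun i => i.2.1) ?_ (x₀ := fun _ => 1 / 2) (r₀ := 1 / 2) (by positivity)
    ?_ ?_
  · intro ε hε
    obtain ⟨n, hn⟩ := exists_nat_gt (1 / ε)
    refine ⟨n, fun i hi => ?_⟩
    have hn0 : (0 : ℝ≥0) < n := (by positivity : (0 : ℝ≥0) < 1 / ε).trans hn
    have hi' : (n : ℝ≥0) ≤ i.1.1 := by exact_mod_cast hi
    calc ρ i.1.1 ≤ 1 / n := by
          simp only [hρ]
          gcongr
          exact min_le_right _ _
      _ < ε := by
          rw [div_lt_iff₀ hε] at hn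
          rwa [div_lt_iff₀ hn0, mul_comm]
  · filter_upwards [hae] with y hy n
    obtain ⟨q, p, hq, hp, hpos, hyp⟩ := hy n
    have hq0 : (0 : ℝ) < q := by exact_mod_cast (Nat.zero_le n).trans_lt hq
    have hρ0 : 0 < ρ q := by
      rw [pos_iff_ne_zero]
      intro h0
      rw [h0, hf.map_zero, NNReal.coe_zero, Real.zero_rpow (by positivity), mul_zero] at hpos
      exact lt_irrefl _ hpos
    refine ⟨⟨(q, p), hρ0, hp⟩, hq.le, ?_⟩
    rwa [mul_div_cancel_left₀ _ hq0.ne'] at hyp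
  · intro y hy h
    rw [closedBall_half_eq_unitCube] at hy
    refine mem_approxSetStar_of_forall_exists hy fun n => ?_
    -- Level n + 1 gives both n < q and q > 0.
    obtain ⟨⟨⟨q, p⟩, hρ0, hp⟩, hq, hyp⟩ := h (n + 1)
    refine ⟨q, p, _, hq, hp, ?_, hyp⟩
    have hq0 : (0 : ℝ≥0) < q := by exact_mod_cast (Nat.succ_pos n).trans_le hq
    have hψ : 0 < ψ q := by
      rw [pos_iff_ne_zero]
      intro h0
      simp only [hρ, h0, zero_div, min_eq_left zero_le_one] at hρ0
      exact lt_irrefl _ hρ0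
    have h1 : ρ q < ψ q / q := by
      simp only [hρ]
      gcongr
      exact (min_le_left _ _).trans_lt (half_lt_self hψ)
    exact_mod_cast h1

end Approximation

/-! ### Conclusion: bounded or unbounded ratio -/

/-- `PiLp p` is `ℝᵏ` with the `ℓᵖ` distance, `1 ≤ p ≤ ∞`: the Euclidean distance for `p = 2`, the
supremum distance for `p = ∞`. -/
theorem theorem3 (p : ℝ≥0∞) [Fact (1 ≤ p)] (k : ℕ) (hk : 2 ≤ k)
    (f : ℝ≥0 → ℝ≥0) (hf : IsDimensionFunction f) (hfk : RatioMonotonic k f)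
    (ψ : ℕ → ℝ≥0)
    (hdiv : ∑' n : ℕ+, ((f (ψ n / (n : ℝ≥0)) * (n : ℝ≥0) ^ k : ℝ≥0) : ℝ≥0∞) = ∞) :
    hausdorffFMeasure f
        ((WithLp.ofLp : PiLp p (fun _ : Fin k => ℝ) → (Fin k → ℝ)) ⁻¹' approxSetStar k ψ) =
      hausdorffFMeasure f
        ((WithLp.ofLp : PiLp p (fun _ : Fin k => ℝ) → (Fin k → ℝ)) ⁻¹' unitCube k) := by
  have hsub : approxSetStar k ψ ⊆ unitCube k := fun y hy => hy.1
  have hdiv' := not_summable_of_tsum_pnat_eq_top (g := fun n => f (ψ n / n) * n ^ k) hdiv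
  have hbdd : (∃ C : ℝ≥0, ∀ a, 0 < a → a ≤ 1 → f a ≤ C * a ^ k) → _ := fun ⟨C, hC⟩ =>
    hausdorffFMeasure_preimage_ofLp_eq (p := p) (by omega) hC hsub
      (volume_unitCube_diff_approxSetStar hk hf.map_zero hC hdiv')
  rcases hfk with hmono | hanti
  · refine hbdd ⟨f 1, fun a ha ha1 => ?_⟩
    have h1 := hmono (Set.mem_Ioi.2 ha) (Set.mem_Ioi.2 one_pos) ha1
    simp only [one_pow, inv_one, one_mul] at h1
    rwa [inv_mul_le_iff₀ (pow_pos ha k), mul_comm] at h1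
  · have hanti' : ∀ a b : ℝ≥0, 0 < a → a ≤ b → f b * a ^ k ≤ f a * b ^ k := by
      intro a b ha hab
      have hb := ha.trans_le hab
      have h1 := hanti (Set.mem_Ioi.2 ha) (Set.mem_Ioi.2 hb) hab
      simp only at h1
      rw [inv_mul_eq_div, inv_mul_eq_div, div_le_div_iff₀ (pow_pos hb k) (pow_pos ha k)] at h1
      exact h1
    -- For a nonincreasing ratio, failing to tend to infinity at 0 means being bounded: each b has
    -- some a ≤ b with ratio below K, and the ratio at b is no larger.
    by_cases hunb : ∀ K : ℝ≥0, ∃ δ > 0, ∀ a, 0 < a → a ≤ δ → K * a ^ k ≤ f a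
    · have h1 : hausdorffFMeasure f
          ((WithLp.ofLp : PiLp p (fun _ : Fin k => ℝ) → (Fin k → ℝ)) ⁻¹' approxSetStar k ψ) = ∞ :=
        top_le_iff.1 ((hausdorffFMeasure_approxSetStar_eq_top hk hf hanti' hunb hdiv').symm.le.trans
          (hausdorffFMeasure_le_preimage_ofLp _))
      rw [h1]
      exact (top_le_iff.1 (h1.symm.le.trans
        (hausdorffFMeasure_mono f (Set.preimage_mono hsub)))).symm
    · push Not at hunb
      obtain ⟨K, hK⟩ := hunb
      refine hbdd ⟨K, fun b hb _ => ?_⟩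
      obtain ⟨a, ha, hab, hlt⟩ := hK b hb
      refine le_of_mul_le_mul_right ((hanti' a b ha hab).trans ?_) (pow_pos ha k)
      calc f a * b ^ k ≤ K * a ^ k * b ^ k := by gcongr
        _ = K * b ^ k * a ^ k := by ring
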